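/- Let $k$ be a commutative ring and let $\mathfrak{C}$ be a small skeletal $k$-linear category. A left (right) $\mathfrak{C}$-module is a covariant (contravariant) $k$-linear functor from $\mathfrak{C}$ to $k$-modules; $\mathrm{Hom}$ and $\mathrm{Ext}$ below are taken in the abelian category of left (respectively right) $\mathfrak{C}$-modules, and the same terminology is used for subcategories of $\mathfrak{C}$. Suppose that $\mathfrak{C}$ is a generalized $k$-linear Reedy category, that is, it is equipped with a degree function $d$ from its objects to the ordinals and with two $k$-linear subcategories $\mathfrak{C}^+$, $\mathfrak{C}^-$ having the same objects as $\mathfrak{C}$, such that for all objects $x, y$: - if $\mathfrak{C}^+(x,y) \neq 0$ then $x=y$ or $d(x)<d(y)$; if $\mathfrak{C}^-(x,y)\neq 0$ then $x=y$ or $d(x)>d(y)$; - $\mathfrak{C}^+(x,x)=\mathfrak{C}^-(x,x)$; this $k$-algebra is denoted by $A_x^0$; - composition induces an isomorphism $\bigoplus_{z}\mathfrak{C}^+(z,y)\otimes_{A_z^0}\mathfrak{C}^-(x,z)\to\mathfrak{C}(x,y)$, the sum being over all objects $z$. Let $\mathfrak{C}^0=\mathfrak{C}^+\cap\mathfrak{C}^-$.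 For an ordinal $\alpha$ let $\mathfrak{I}_\alpha(x,y)\subseteq\mathfrak{C}(x,y)$ be the $k$-submodule spanned by the composites $f\circ g$ with $g\in\mathfrak{C}^-(x,z)$, $f\in\mathfrak{C}^+(z,y)$ and $d(z)<\alpha$; this defines a two-sided ideal of $\mathfrak{C}$. For an object $x$ with $d(x)=\alpha$ let $\Delta_x=\mathfrak{C}(x,-)/\mathfrak{I}_\alpha(x,-)$ and $\Delta^x=\mathfrak{C}(-,x)/\mathfrak{I}_\alpha(-,x)$ be the left and the right standard module. Regard $A_x^0$ as the left $\mathfrak{C}^-$-module concentrated on $x$ that is the quotient of $\mathfrak{C}^-(x,-)$ by all its values on objects of degree $<\alpha$, and as the right $\mathfrak{C}^+$-module concentrated on $x$ that is the quotient of $\mathfrak{C}^+(-,x)$ by all its values on objects of degree $<\alpha$. **(1)** Suppose that $\mathfrak{C}^+$, that is $\bigoplus_{y}\mathfrak{C}^+(-,y)$, is a projective right $\mathfrak{C}^0$-module. Then for all objects $x,y$: (a) $\Delta_x\cong\mathfrak{C}\otimes_{\mathfrak{C}^-}A_x^0$ as left $\mathfrak{C}$-modules; (b) $\mathrm{End}_{\mathfrak{C}}(\Delta_x)\cong(A_x^0)^{\mathrm{op}}$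 as $k$-algebras; (c) $\mathrm{Hom}_{\mathfrak{C}}(\Delta_x,\Delta_y)\neq0$ only if $x=y$ or $d(x)>d(y)$; (d) for $n\geq1$, $\mathrm{Ext}^n_{\mathfrak{C}}(\Delta_x,\Delta_y)\neq0$ only if $d(x)>d(y)$. **(2)** Suppose that $\mathfrak{C}^-$, that is $\bigoplus_{x}\mathfrak{C}^-(x,-)$, is a projective left $\mathfrak{C}^0$-module. Then for all objects $x,y$: (a) $\Delta^x\cong A_x^0\otimes_{\mathfrak{C}^+}\mathfrak{C}$ as right $\mathfrak{C}$-modules; (b) $\mathrm{End}_{\mathfrak{C}}(\Delta^x)\cong A_x^0$ as $k$-algebras; (c) $\mathrm{Hom}_{\mathfrak{C}}(\Delta^x,\Delta^y)\neq0$ only if $x=y$ or $d(x)>d(y)$; (d) for $n\geq1$, $\mathrm{Ext}^n_{\mathfrak{C}}(\Delta^x,\Delta^y)\neq0$ only if $d(x)>d(y)$. -/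

import Mathlib

open CategoryTheory CategoryTheory.Limits Opposite
open scoped TensorProduct DirectSum

universe u

noncomputable section

namespace LinReedy

/-! ## Modules over a small linear category -/

section Modules

variable (k : Type u) [CommRing k] (D : Type u) [SmallCategory D] [Preadditive D] [Linear k D]

/-- The opposite of a `k`-linear category is `k`-linear. -/
instance linearOpposite : Linear k Dᵒᵖ where
  homModule _ _ :=
    { smul := fun r f => (r • f.unop).op
      one_smul := fun f => Quiver.Hom.unop_inj (one_smul k f.unop)
      mul_smul := fun r s f => Quiver.Hom.unop_inj (mul_smul r s f.unop)
      smul_zero := fun r => Quiver.Hom.unop_inj (smul_zero r)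
      smul_add := fun r f g => Quiver.Hom.unop_inj (smul_add r f.unop g.unop)
      add_smul := fun r s f => Quiver.Hom.unop_inj (add_smul r s f.unop)
      zero_smul := fun f => Quiver.Hom.unop_inj (zero_smul k f.unop) }
  smul_comp _ _ _ r f g := Quiver.Hom.unop_inj (Linear.comp_smul _ _ _ g.unop r f.unop)
  comp_smul _ _ _ f r g := Quiver.Hom.unop_inj (Linear.smul_comp _ _ _ r g.unop f.unop)

/-- The functors `D ⥤ k-Mod` that are `k`-linear on morphisms. -/
def isLinear : ObjectProperty (D ⥤ ModuleCat.{u} k) :=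
  fun F => F.Additive ∧ F.Linear k

variable {k D} in
lemma isLinear_of_mono {F G : D ⥤ ModuleCat.{u} k} (i : F ⟶ G) [Mono i]
    (hG : isLinear k D G) : isLinear k D F := by
  obtain ⟨h1, h2⟩ := hG
  refine ⟨⟨fun {X Y f g} => ?_⟩, ⟨fun {X Y} f r => ?_⟩⟩
  · rw [← cancel_mono (i.app Y)]
    simp [Preadditive.add_comp]
  · rw [← cancel_mono (i.app Y)]
    simp [Linear.smul_comp]

variable {k D} in
lemma isLinear_of_epi {F G : D ⥤ ModuleCat.{u} k} (p : F ⟶ G) [Epi p]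
    (hF : isLinear k D F) : isLinear k D G := by
  obtain ⟨h1, h2⟩ := hF
  refine ⟨⟨fun {X Y f g} => ?_⟩, ⟨fun {X Y} f r => ?_⟩⟩
  · rw [← cancel_epi (p.app X), ← p.naturality]
    simp only [F.map_add, Preadditive.add_comp, Preadditive.comp_add, p.naturality]
  · rw [← cancel_epi (p.app X), ← p.naturality]
    simp only [F.map_smul, Linear.smul_comp, Linear.comp_smul, p.naturality]

instance : (isLinear k D).ContainsZero where
  exists_zero := by
    have h : IsZero ((Functor.const D).obj (ModuleCat.of k PUnit.{u + 1})) :=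
      (Functor.isZero_iff _).2 fun X => by
        dsimp
        exact ModuleCat.isZero_of_subsingleton _
    refine ⟨_, h, ⟨fun {X _ _ _} => ?_⟩, ⟨fun {X _} _ _ => ?_⟩⟩
    · exact (h.obj X).eq_of_src _ _
    · exact (h.obj X).eq_of_src _ _

instance : (isLinear k D).IsClosedUnderKernels where
  kernels_le := by
    rintro _ ⟨f, c, hc, hf⟩
    have : Mono c.ι := mono_of_isLimit_fork hc
    exact isLinear_of_mono c.ι hf.1

instance : (isLinear k D).IsClosedUnderCokernels where
  cokernels_le := by
    rintro _ ⟨f, c, hc, hf⟩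
    have : Epi c.π := epi_of_isColimit_cofork hc
    exact isLinear_of_epi c.π hf.2

instance : (isLinear k D).IsClosedUnderFiniteProducts where
  isClosedUnderLimitsOfShape J _ := ⟨by
    rintro F ⟨p⟩
    have ext_at : ∀ (Y : D) (Z : ModuleCat.{u} k) (a b : Z ⟶ F.obj Y),
        (∀ j, a ≫ (p.π.app j).app Y = b ≫ (p.π.app j).app Y) → a = b := fun Y Z a b h =>
      (isLimitOfPreserves ((evaluation D (ModuleCat.{u} k)).obj Y) p.isLimit).hom_ext h
    refine ⟨⟨fun {X Y f g} => ext_at _ _ _ _ fun j => ?_⟩,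
      ⟨fun {X Y} f r => ext_at _ _ _ _ fun j => ?_⟩⟩
    · have := (p.prop_diag_obj j).1
      have e := fun h => (p.π.app j).naturality (X := X) (Y := Y) h
      dsimp at e
      simp only [Functor.map_add, Preadditive.add_comp, Preadditive.comp_add, e]
    · have := (p.prop_diag_obj j).2
      have e := fun h => (p.π.app j).naturality (X := X) (Y := Y) h
      dsimp at e
      simp only [Functor.map_smul, Linear.smul_comp, Linear.comp_smul, e]⟩

/-- The category of left `D`-modules: `k`-linear functors `D ⥤ k-Mod` and natural
transformations. -/
abbrev LMod : Type (u + 1) := (isLinear k D).FullSubcategory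

/-- The category of right `D`-modules: left modules over the opposite category. -/
abbrev RMod : Type (u + 1) := LMod k Dᵒᵖ

instance hasExt : HasExt.{u + 1} (LMod k D) := HasExt.standard _

variable {k D}

/-- The quotient of the representable left module `D(x, -)` by a family `J` of submodules that is
stable under composition with the morphisms of `D`. -/
def quotRep (x : D) (J : ∀ y : D, Submodule k (x ⟶ y))
    (hJ : ∀ {y z : D} (f : x ⟶ y) (g : y ⟶ z), f ∈ J y → f ≫ g ∈ J z) : LMod k D where
  obj :=
    { obj := fun y => ModuleCat.of k ((x ⟶ y) ⧸ J y)
      map := fun {y z} g => ModuleCat.ofHom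
        ((J y).mapQ (J z) (Linear.rightComp k x g) fun f hf => hJ f g hf)
      map_id := fun y => by
        ext f
        exact congrArg (J y).mkQ (Category.comp_id f)
      map_comp := fun {y z w} g h => by
        ext f
        exact congrArg (J w).mkQ (Category.assoc f g h).symm }
  property := by
    refine ⟨⟨fun {y z f g} => ?_⟩, ⟨fun {y z} f r => ?_⟩⟩
    · ext a
      exact congrArg (J z).mkQ (Preadditive.comp_add _ _ _ a f g)
    · ext a
      exact congrArg (J z).mkQ (Linear.comp_smul _ _ _ a r f)

end Modules

/-! ## The tensor product of a right and a left module -/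

section Tensor

variable {k : Type u} [CommRing k] {D : Type u} [SmallCategory D]

/-- The relations `n a ⊗ m = n ⊗ a m` for `a : z ⟶ w` in `D`, `n ∈ N(w)`, `m ∈ M(z)`. -/
def tensorRel (N : Dᵒᵖ ⥤ ModuleCat.{u} k) (M : D ⥤ ModuleCat.{u} k) :
    Submodule k (⨁ z : D, (N.obj (op z) ⊗[k] M.obj z)) := by
  classical
  exact Submodule.span k
    { t | ∃ (z w : D) (a : z ⟶ w) (n : N.obj (op w)) (m : M.obj z),
      t = DirectSum.lof k D (fun z => (N.obj (op z) ⊗[k] M.obj z)) z ((N.map a.op) n ⊗ₜ[k] m)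
        - DirectSum.lof k D (fun z => (N.obj (op z) ⊗[k] M.obj z)) w (n ⊗ₜ[k] (M.map a) m) }

/-- The tensor product `N ⊗_D M` of a right `D`-module `N` and a left `D`-module `M`: the quotient
of `⨁ z, N(z) ⊗ M(z)` by the relations `n a ⊗ m = n ⊗ a m`. -/
abbrev tensorOver (N : Dᵒᵖ ⥤ ModuleCat.{u} k) (M : D ⥤ ModuleCat.{u} k) : Type u :=
  (⨁ z : D, (N.obj (op z) ⊗[k] M.obj z)) ⧸ tensorRel N M

/-- Functoriality of the tensor product over `D`. -/
def tensorMap {N N' : Dᵒᵖ ⥤ ModuleCat.{u} k} {M M' : D ⥤ ModuleCat.{u} k} (φ : N ⟶ N')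
    (ψ : M ⟶ M') : tensorOver N M →ₗ[k] tensorOver N' M' :=
  (tensorRel N M).mapQ (tensorRel N' M')
    (DirectSum.lmap fun z => TensorProduct.map (φ.app (op z)).hom (ψ.app z).hom) (by
      classical
      unfold tensorRel
      rw [Submodule.span_le]
      rintro _ ⟨z, w, a, n, m, rfl⟩
      refine Submodule.subset_span ⟨z, w, a, (φ.app (op w)).hom n, (ψ.app z).hom m, ?_⟩
      have h1 := ConcreteCategory.congr_hom (φ.naturality a.op) n
      have h2 := ConcreteCategory.congr_hom (ψ.naturality a) m
      simp only [ConcreteCategory.comp_apply] at h1 h2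
      simp only [map_sub, DirectSum.lmap_lof, TensorProduct.map_tmul]
      erw [h1, h2])

lemma tensorOver_hom_ext {N : Dᵒᵖ ⥤ ModuleCat.{u} k} {M : D ⥤ ModuleCat.{u} k} {P : Type u}
    [AddCommGroup P] [Module k P] [DecidableEq D] {f g : tensorOver N M →ₗ[k] P}
    (h : ∀ (z : D) (n : N.obj (op z)) (m : M.obj z),
      f ((tensorRel N M).mkQ (DirectSum.lof k D (fun z => (N.obj (op z) ⊗[k] M.obj z)) z (n ⊗ₜ m)))
      = g ((tensorRel N M).mkQ
        (DirectSum.lof k D (fun z => (N.obj (op z) ⊗[k] M.obj z)) z (n ⊗ₜ m)))) :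
    f = g := by
  refine Submodule.linearMap_qext _ (DirectSum.linearMap_ext _ fun z => ?_)
  exact TensorProduct.ext' fun n m => h z n m

lemma tensorMap_mk [DecidableEq D] {N N' : Dᵒᵖ ⥤ ModuleCat.{u} k} {M M' : D ⥤ ModuleCat.{u} k}
    (φ : N ⟶ N') (ψ : M ⟶ M') (z : D) (n : N.obj (op z)) (m : M.obj z) :
    tensorMap φ ψ ((tensorRel N M).mkQ
      (DirectSum.lof k D (fun z => (N.obj (op z) ⊗[k] M.obj z)) z (n ⊗ₜ m))) =
    (tensorRel N' M').mkQ (DirectSum.lof k D (fun z => (N'.obj (op z) ⊗[k] M'.obj z)) z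
      ((φ.app (op z)).hom n ⊗ₜ (ψ.app z).hom m)) := by
  simp only [tensorMap, Submodule.mkQ_apply, Submodule.mapQ_apply, DirectSum.lmap_lof,
    TensorProduct.map_tmul]

variable {N N' N'' : Dᵒᵖ ⥤ ModuleCat.{u} k} {M M' M'' : D ⥤ ModuleCat.{u} k}

lemma tensorMap_id : tensorMap (𝟙 N) (𝟙 M) = LinearMap.id := by
  classical
  exact tensorOver_hom_ext fun z n m => tensorMap_mk _ _ z n m

lemma tensorMap_comp (φ : N ⟶ N') (φ' : N' ⟶ N'') (ψ : M ⟶ M') (ψ' : M' ⟶ M'') :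
    tensorMap (φ ≫ φ') (ψ ≫ ψ') = tensorMap φ' ψ' ∘ₗ tensorMap φ ψ := by
  classical
  refine tensorOver_hom_ext fun z n m => ?_
  rw [LinearMap.comp_apply, tensorMap_mk, tensorMap_mk, tensorMap_mk]
  rfl

lemma tensorMap_add_left (φ φ' : N ⟶ N') (ψ : M ⟶ M') :
    tensorMap (φ + φ') ψ = tensorMap φ ψ + tensorMap φ' ψ := by
  classical
  refine tensorOver_hom_ext fun z n m => ?_
  rw [LinearMap.add_apply, tensorMap_mk, tensorMap_mk, tensorMap_mk, ← map_add, ← map_add,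
    ← TensorProduct.add_tmul]
  rfl

lemma tensorMap_smul_left (r : k) (φ : N ⟶ N') (ψ : M ⟶ M') :
    tensorMap (r • φ) ψ = r • tensorMap φ ψ := by
  classical
  refine tensorOver_hom_ext fun z n m => ?_
  rw [LinearMap.smul_apply, tensorMap_mk, tensorMap_mk, ← map_smul, ← map_smul,
    TensorProduct.smul_tmul']
  rfl

lemma tensorMap_add_right (φ : N ⟶ N') (ψ ψ' : M ⟶ M') :
    tensorMap φ (ψ + ψ') = tensorMap φ ψ + tensorMap φ ψ' := by
  classical
  refine tensorOver_hom_ext fun z n m => ?_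
  rw [LinearMap.add_apply, tensorMap_mk, tensorMap_mk, tensorMap_mk, ← map_add, ← map_add,
    ← TensorProduct.tmul_add]
  rfl

lemma tensorMap_smul_right (r : k) (φ : N ⟶ N') (ψ : M ⟶ M') :
    tensorMap φ (r • ψ) = r • tensorMap φ ψ := by
  classical
  refine tensorOver_hom_ext fun z n m => ?_
  rw [LinearMap.smul_apply, tensorMap_mk, tensorMap_mk, ← map_smul, ← map_smul,
    ← TensorProduct.tmul_smul]
  rfl

end Tensor

/-! ## Linear subcategories and induction -/

section Sub

variable (k : Type u) [CommRing k] (C : Type u) [SmallCategory C] [Preadditive C] [Linear k C]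

/-- A `k`-linear subcategory with the same objects as `C`. -/
structure LinSub where
  /-- the morphisms of the subcategory -/
  hom : ∀ x y : C, Submodule k (x ⟶ y)
  id_mem : ∀ x : C, 𝟙 x ∈ hom x x
  comp_mem : ∀ {x y z : C} {f : x ⟶ y} {g : y ⟶ z}, f ∈ hom x y → g ∈ hom y z → f ≫ g ∈ hom x z

variable {k C}

namespace LinSub

/-- The objects of a subcategory with the same objects as `C`. -/
structure Obj (S : LinSub k C) : Type u where
  /-- the underlying object of `C` -/
  as : C

variable (S : LinSub k C)

instance : SmallCategory S.Obj where
  Hom x y := S.hom x.as y.as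
  id x := ⟨𝟙 x.as, S.id_mem x.as⟩
  comp f g := ⟨f.1 ≫ g.1, S.comp_mem f.2 g.2⟩
  id_comp f := Subtype.ext (Category.id_comp f.1)
  comp_id f := Subtype.ext (Category.comp_id f.1)
  assoc f g h := Subtype.ext (Category.assoc f.1 g.1 h.1)

instance : Preadditive S.Obj where
  homGroup x y := inferInstanceAs (AddCommGroup (S.hom x.as y.as))
  add_comp _ _ _ f f' g := Subtype.ext (Preadditive.add_comp _ _ _ f.1 f'.1 g.1)
  comp_add _ _ _ f g g' := Subtype.ext (Preadditive.comp_add _ _ _ f.1 g.1 g'.1)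

instance : Linear k S.Obj where
  homModule x y := inferInstanceAs (Module k (S.hom x.as y.as))
  smul_comp _ _ _ r f g := Subtype.ext (Linear.smul_comp _ _ _ r f.1 g.1)
  comp_smul _ _ _ f r g := Subtype.ext (Linear.comp_smul _ _ _ f.1 r g.1)

/-- The inclusion functor. -/
def incl : S.Obj ⥤ C where
  obj x := x.as
  map f := f.1

/-- The intersection of two subcategories. -/
def inter (S T : LinSub k C) : LinSub k C where
  hom x y := S.hom x y ⊓ T.hom x y
  id_mem x := ⟨S.id_mem x, T.id_mem x⟩
  comp_mem hf hg := ⟨S.comp_mem hf.1 hg.1, T.comp_mem hf.2 hg.2⟩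

/-- The left `C`-module `C ⊗_S M` induced from a left `S`-module `M`: its value at `y` is
`C(-, y) ⊗_S M`, and `C` acts by composition on `C(-, y)`. -/
def inductionLeft (M : LMod k S.Obj) : LMod k C where
  obj :=
    { obj := fun y => ModuleCat.of k (tensorOver (S.incl.op ⋙ (linearYoneda k C).obj y) M.obj)
      map := fun f => ModuleCat.ofHom
        (tensorMap (Functor.whiskerLeft S.incl.op ((linearYoneda k C).map f)) (𝟙 M.obj))
      map_id := fun y => by
        rw [CategoryTheory.Functor.map_id, Functor.whiskerLeft_id', tensorMap_id]
        rfl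
      map_comp := fun f g => by
        rw [Functor.map_comp, Functor.whiskerLeft_comp, ← ModuleCat.ofHom_comp, ← tensorMap_comp,
          Category.comp_id] }
  property := by
    refine ⟨⟨fun {y z f g} => ?_⟩, ⟨fun {y z} f r => ?_⟩⟩
    · refine ModuleCat.hom_ext ((congrArg (tensorMap · (𝟙 M.obj)) ?_).trans
        (tensorMap_add_left _ _ _))
      ext w h
      exact Preadditive.comp_add _ _ _ h f g
    · refine ModuleCat.hom_ext ((congrArg (tensorMap · (𝟙 M.obj)) ?_).trans
        (tensorMap_smul_left _ _ _))
      ext w h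
      exact Linear.comp_smul _ _ _ h r f

/-- The right `C`-module `N ⊗_S C` induced from a right `S`-module `N`: its value at `y` is
`N ⊗_S C(y, -)`, and `C` acts by composition on `C(y, -)`. -/
def inductionRight (N : RMod k S.Obj) : RMod k C where
  obj :=
    { obj := fun y => ModuleCat.of k (tensorOver N.obj (S.incl ⋙ (linearCoyoneda k C).obj y))
      map := fun f => ModuleCat.ofHom
        (tensorMap (𝟙 N.obj) (Functor.whiskerLeft S.incl ((linearCoyoneda k C).map f)))
      map_id := fun y => by
        rw [CategoryTheory.Functor.map_id, Functor.whiskerLeft_id', tensorMap_id]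
        rfl
      map_comp := fun f g => by
        rw [Functor.map_comp, Functor.whiskerLeft_comp, ← ModuleCat.ofHom_comp, ← tensorMap_comp,
          Category.comp_id] }
  property := by
    refine ⟨⟨fun {y z f g} => ?_⟩, ⟨fun {y z} f r => ?_⟩⟩
    · refine ModuleCat.hom_ext ((congrArg (tensorMap (𝟙 N.obj) ·) ?_).trans
        (tensorMap_add_right _ _ _))
      ext w h
      exact Preadditive.add_comp _ _ _ f.unop g.unop h
    · refine ModuleCat.hom_ext ((congrArg (tensorMap (𝟙 N.obj) ·) ?_).trans
        (tensorMap_smul_right _ _ _))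
      ext w h
      exact Linear.smul_comp _ _ _ r f.unop h

end LinSub
/-! ### Tensor products over the local endomorphism algebras -/

/-- The relations `f a ⊗ g = f ⊗ a g` for `f ∈ P(z, y)`, `g ∈ M(x, z)` and `a ∈ (P ∩ M)(z, z)`. -/
def balanced (P M : LinSub k C) (x y z : C) : Submodule k (P.hom z y ⊗[k] M.hom x z) :=
  Submodule.span k
    { t | ∃ (a : z ⟶ z) (ha : a ∈ (P.inter M).hom z z) (f : P.hom z y) (g : M.hom x z),
      t = (⟨a ≫ f.1, P.comp_mem ha.1 f.2⟩ : P.hom z y) ⊗ₜ[k] g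
        - f ⊗ₜ[k] (⟨g.1 ≫ a, M.comp_mem g.2 ha.2⟩ : M.hom x z) }

/-- The map `f ⊗ g ↦ f ∘ g` from `P(z, y) ⊗_k M(x, z)` to `C(x, y)`. -/
def compTensor (P M : LinSub k C) (x y z : C) : P.hom z y ⊗[k] M.hom x z →ₗ[k] (x ⟶ y) :=
  TensorProduct.lift (LinearMap.mk₂ k (fun f g => g.1 ≫ f.1)
    (fun _ _ _ => Preadditive.comp_add _ _ _ _ _ _) (fun _ _ _ => Linear.comp_smul _ _ _ _ _ _)
    (fun _ _ _ => Preadditive.add_comp _ _ _ _ _ _) (fun _ _ _ => Linear.smul_comp _ _ _ _ _ _))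

lemma balanced_le_ker (P M : LinSub k C) (x y z : C) :
    balanced P M x y z ≤ LinearMap.ker (compTensor P M x y z) := by
  refine Submodule.span_le.2 ?_
  rintro _ ⟨a, ha, f, g, rfl⟩
  simp [compTensor]

/-- The map from the direct sum over all objects `z` of the `P(z, y) ⊗_A M(x, z)`, where `A` is
`(P ∩ M)(z, z)`, to `C(x, y)` that is induced by composition. -/
def rho (P M : LinSub k C) (x y : C) :
    (⨁ z : C, (P.hom z y ⊗[k] M.hom x z) ⧸ balanced P M x y z) →ₗ[k] (x ⟶ y) := by
  classical
  exact DirectSum.toModule k C _ fun z =>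
    (balanced P M x y z).liftQ (compTensor P M x y z) (balanced_le_ker P M x y z)

end Sub

/-! ## Generalized linear Reedy categories -/

/-- The structure of a generalized `k`-linear Reedy category on a small `k`-linear category `C`. -/
structure GenReedy (k : Type u) [CommRing k] (C : Type u) [SmallCategory C] [Preadditive C]
    [Linear k C] where
  /-- `C` is skeletal. -/
  skeletal : Skeletal C
  /-- the degree function -/
  deg : C → Ordinal.{u}
  /-- the subcategory of degree raising morphisms -/
  plus : LinSub k C
  /-- the subcategory of degree lowering morphisms -/
  minus : LinSub k C
  plus_deg : ∀ {x y : C} (f : x ⟶ y), f ∈ plus.hom x y → f ≠ 0 → x = y ∨ deg x < deg y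
  minus_deg : ∀ {x y : C} (f : x ⟶ y), f ∈ minus.hom x y → f ≠ 0 → x = y ∨ deg y < deg x
  plus_self : ∀ x : C, plus.hom x x = minus.hom x x
  rho_bijective : ∀ x y : C, Function.Bijective (rho plus minus x y)

namespace GenReedy

variable {k : Type u} [CommRing k] {C : Type u} [SmallCategory C] [Preadditive C] [Linear k C]
variable (R : GenReedy k C)

/-- The subcategory `C⁰`, the intersection of `C⁺` and `C⁻`. -/
def zero : LinSub k C := R.plus.inter R.minus

/-- The local endomorphism algebra `A_x⁰ = C⁰(x, x)`; its product is the composition of maps. -/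
abbrev localAlg (x : C) : Type u := End (⟨x⟩ : R.zero.Obj)

/-! ### The ideals -/

/-- The two-sided ideal `I_α`: `I_α(x, y)` is spanned by the composites of a morphism `x ⟶ z` in
`C⁻` and a morphism `z ⟶ y` in `C⁺` with `deg z < α`. -/
def ideal (α : Ordinal.{u}) (x y : C) : Submodule k (x ⟶ y) :=
  Submodule.span k { h | ∃ (z : C) (g : x ⟶ z) (f : z ⟶ y),
    R.deg z < α ∧ g ∈ R.minus.hom x z ∧ f ∈ R.plus.hom z y ∧ h = g ≫ f }

lemma mem_span (x y : C) (h : x ⟶ y) :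
    h ∈ Submodule.span k { h | ∃ (z : C) (g : x ⟶ z) (f : z ⟶ y),
      g ∈ R.minus.hom x z ∧ f ∈ R.plus.hom z y ∧ h = g ≫ f } := by
  classical
  obtain ⟨t, rfl⟩ := (R.rho_bijective x y).2 h
  induction t using DirectSum.induction_on with
  | zero => rw [map_zero]; exact zero_mem _
  | add a b ha hb => rw [map_add]; exact add_mem ha hb
  | of z q =>
    obtain ⟨q, rfl⟩ := Submodule.Quotient.mk_surjective _ q
    have e : rho R.plus R.minus x y
        (DirectSum.of (fun z => (R.plus.hom z y ⊗[k] R.minus.hom x z) ⧸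
          balanced R.plus R.minus x y z) z (Submodule.Quotient.mk q)) =
        compTensor R.plus R.minus x y z q := by
      unfold rho
      erw [DirectSum.toModule_lof]
      rfl
    rw [e]
    clear e
    induction q using TensorProduct.induction_on with
    | zero => rw [map_zero]; exact zero_mem _
    | add a b ha hb =>
      rw [map_add]
      exact add_mem ha hb
    | tmul f g => exact Submodule.subset_span ⟨z, g.1, f.1, g.2, f.2, rfl⟩

lemma ideal_comp (α : Ordinal.{u}) {x y w : C} (h : x ⟶ y) (l : y ⟶ w) (hh : h ∈ R.ideal α x y) :
    h ≫ l ∈ R.ideal α x w := by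
  suffices R.ideal α x y ≤ (R.ideal α x w).comap (Linear.rightComp k x l) from this hh
  refine Submodule.span_le.2 ?_
  rintro _ ⟨z, g, f, hz, hg, hf, rfl⟩
  show (g ≫ f) ≫ l ∈ R.ideal α x w
  rw [Category.assoc]
  generalize f ≫ l = q
  have := R.mem_span z w q
  suffices h : Submodule.span k _ ≤ (R.ideal α x w).comap (Linear.leftComp k w g) from h this
  refine Submodule.span_le.2 ?_
  rintro _ ⟨v, g', f', hg', hf', rfl⟩
  show g ≫ g' ≫ f' ∈ R.ideal α x w
  by_cases h0 : g' = 0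
  · rw [h0, zero_comp, comp_zero]
    exact zero_mem _
  refine Submodule.subset_span ⟨v, g ≫ g', f', ?_, R.minus.comp_mem hg hg', hf',
    (Category.assoc _ _ _).symm⟩
  rcases R.minus_deg g' hg' h0 with rfl | h
  · exact hz
  · exact h.trans hz

lemma comp_ideal (α : Ordinal.{u}) {w x y : C} (l : w ⟶ x) (h : x ⟶ y) (hh : h ∈ R.ideal α x y) :
    l ≫ h ∈ R.ideal α w y := by
  suffices R.ideal α x y ≤ (R.ideal α w y).comap (Linear.leftComp k y l) from this hh
  refine Submodule.span_le.2 ?_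
  rintro _ ⟨z, g, f, hz, hg, hf, rfl⟩
  show l ≫ g ≫ f ∈ R.ideal α w y
  rw [← Category.assoc]
  generalize l ≫ g = q
  have := R.mem_span w z q
  suffices h : Submodule.span k _ ≤ (R.ideal α w y).comap (Linear.rightComp k w f) from h this
  refine Submodule.span_le.2 ?_
  rintro _ ⟨v, g', f', hg', hf', rfl⟩
  show (g' ≫ f') ≫ f ∈ R.ideal α w y
  by_cases h0 : f' = 0
  · rw [h0, comp_zero, zero_comp]
    exact zero_mem _
  refine Submodule.subset_span ⟨v, g', f' ≫ f, ?_, hg', R.plus.comp_mem hf' hf,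
    Category.assoc _ _ _⟩
  rcases R.plus_deg f' hf' h0 with rfl | h
  · exact hz
  · exact h.trans hz

/-! ### Standard modules -/

/-- The left standard module `Δ_x = C(x, -) / I_α(x, -)` with `α = deg x`. -/
def stdLeft (x : C) : LMod k C :=
  quotRep x (fun y => R.ideal (R.deg x) x y) fun f g hf => R.ideal_comp _ f g hf

/-- The right standard module `Δ^x = C(-, x) / I_α(-, x)` with `α = deg x`. -/
def stdRight (x : C) : RMod k C :=
  quotRep (op x)
    (fun y =>
      { carrier := { f | f.unop ∈ R.ideal (R.deg x) y.unop x }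
        add_mem' := fun ha hb => (R.ideal (R.deg x) _ x).add_mem ha hb
        zero_mem' := zero_mem (R.ideal (R.deg x) _ x)
        smul_mem' := fun r _ ha => (R.ideal (R.deg x) _ x).smul_mem r ha })
    fun f g hf => R.comp_ideal _ g.unop f.unop hf

/-! ### The local algebras as modules over `C⁻` and `C⁺` -/

open scoped Classical in
/-- The left `C⁻`-module `A_x⁰`, concentrated on the object `x`: the quotient of `C⁻(x, -)` by
all its values on objects of degree less than `deg x`. As `C⁻(x, y)` vanishes for every other
`y ≠ x`, what remains is `C⁻(x, x) = A_x⁰`. -/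
def localLeft (x : C) : LMod k R.minus.Obj :=
  quotRep (⟨x⟩ : R.minus.Obj) (fun y => if R.deg y.as < R.deg x then ⊤ else ⊥) (by
    intro y z f g hf
    split_ifs with hz
    · trivial
    · split_ifs at hf with hy
      · have hg : g = 0 := by
          by_contra h
          rcases R.minus_deg g.1 g.2 (fun h' => h (Subtype.ext h')) with h' | h'
          · exact hz (h' ▸ hy)
          · exact hz (h'.trans hy)
        rw [hg, comp_zero]
        exact zero_mem _
      · rw [(Submodule.mem_bot k).1 hf, zero_comp]
        exact zero_mem _)

open scoped Classical in
/-- The right `C⁺`-module `A_x⁰`, concentrated on the object `x`: the quotient of `C⁺(-, x)` by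
all its values on objects of degree less than `deg x`. As `C⁺(y, x)` vanishes for every other
`y ≠ x`, what remains is `C⁺(x, x) = A_x⁰`. -/
def localRight (x : C) : RMod k R.plus.Obj :=
  quotRep (op (⟨x⟩ : R.plus.Obj)) (fun y => if R.deg y.unop.as < R.deg x then ⊤ else ⊥) (by
    intro y z f g hf
    split_ifs with hz
    · trivial
    · split_ifs at hf with hy
      · have hg : g = 0 := by
          by_contra h
          rcases R.plus_deg g.unop.1 g.unop.2
            (fun h' => h (Quiver.Hom.unop_inj (Subtype.ext h'))) with h' | h'
          · exact hz (h' ▸ hy)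
          · exact hz (h'.trans hy)
        rw [hg, comp_zero]
        exact zero_mem _
      · rw [(Submodule.mem_bot k).1 hf, zero_comp]
        exact zero_mem _)

/-! ### `C⁺` and `C⁻` as `C⁰`-modules -/

/-- `C⁺` as a right `C⁰`-module: its value at `z` is the direct sum of all `C⁺(z, y)`. -/
def plusRight : RMod k R.zero.Obj where
  obj :=
    { obj := fun z => ModuleCat.of k (⨁ y : C, R.plus.hom z.unop.as y)
      map := fun a => ModuleCat.ofHom (DirectSum.lmap fun y =>
        (Linear.leftComp k y a.unop.1).restrict fun _ hf => R.plus.comp_mem a.unop.2.1 hf)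
      map_id := fun z => ModuleCat.hom_ext <| LinearMap.ext fun t => DFinsupp.ext fun _ =>
        Subtype.ext (Category.id_comp _)
      map_comp := fun a b => ModuleCat.hom_ext <| LinearMap.ext fun t => DFinsupp.ext fun _ =>
        Subtype.ext (Category.assoc b.unop.1 a.unop.1 _) }
  property := by
    refine ⟨⟨fun {_ _ a b} => ?_⟩, ⟨fun {_ _} a r => ?_⟩⟩
    · exact ModuleCat.hom_ext <| LinearMap.ext fun t => DFinsupp.ext fun _ =>
        Subtype.ext (Preadditive.add_comp _ _ _ a.unop.1 b.unop.1 _)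
    · exact ModuleCat.hom_ext <| LinearMap.ext fun t => DFinsupp.ext fun _ =>
        Subtype.ext (Linear.smul_comp _ _ _ r a.unop.1 _)

/-- `C⁻` as a left `C⁰`-module: its value at `z` is the direct sum of all `C⁻(x, z)`. -/
def minusLeft : LMod k R.zero.Obj where
  obj :=
    { obj := fun z => ModuleCat.of k (⨁ x : C, R.minus.hom x z.as)
      map := fun a => ModuleCat.ofHom (DirectSum.lmap fun x =>
        (Linear.rightComp k x a.1).restrict fun _ hf => R.minus.comp_mem hf a.2.2)
      map_id := fun z => ModuleCat.hom_ext <| LinearMap.ext fun t => DFinsupp.ext fun _ =>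
        Subtype.ext (Category.comp_id _)
      map_comp := fun a b => ModuleCat.hom_ext <| LinearMap.ext fun t => DFinsupp.ext fun _ =>
        Subtype.ext ((Category.assoc _ a.1 b.1).symm) }
  property := by
    refine ⟨⟨fun {_ _ a b} => ?_⟩, ⟨fun {_ _} a r => ?_⟩⟩
    · exact ModuleCat.hom_ext <| LinearMap.ext fun t => DFinsupp.ext fun _ =>
        Subtype.ext (Preadditive.comp_add _ _ _ _ a.1 b.1)
    · exact ModuleCat.hom_ext <| LinearMap.ext fun t => DFinsupp.ext fun _ =>
        Subtype.ext (Linear.comp_smul _ _ _ _ r a.1)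

end GenReedy

end LinReedy

/-! The decomposition of morphisms gives two facts. First, `C(x, -)` is the direct sum of `C⁺(x, -)`
and the ideal `I_α(x, -)`, `α = deg x`: a nonzero `g` in `C⁻(x, z)` has `z = x`, where it lies in
`C⁺(x, x)`, or `deg z < α`. Hence `Δ_x(y)` is a copy of `C⁺(x, y)` and vanishes unless `y = x` or
`deg x < deg y`. A morphism `Δ_x ⟶ Δ_y` is determined by the image of the generator in `Δ_y(x)`,
which gives the statement on Hom; for `x = y` every element of `Δ_x(x)` is an admissible image,
because the ideal is two-sided, and `Δ_x(x)` is `A_x⁰`. Precomposition reverses products, hence the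
opposite algebra.

Secondly, `C(-, y)` is `C⁺(-, y) ⊗ C⁻` over `C⁰`. If `C⁺` is projective over `C⁰`, then `C(-, y)` is
projective over `C⁻` (`PlusDualBasis.projective_restrictedRep`), so induction from `C⁻` to `C` is
exact. It preserves projectives, being left adjoint to the exact restriction.

For Ext, `Δ_x` is induced from the local module `A_x⁰` (`stdIsoInd`). The kernel of `C⁻(x, -) ⟶
A_x⁰` lives in degrees below `deg x`. A `C⁻`-module living in degrees below `β` has a free cover
whose kernel again lives below `β`, since `C⁻` only lowers degrees. Dimension shifting therefore
reduces `Extⁿ(Δ_x, Δ_y)`, `n ≥ 1`, to morphisms from an induced module `Ind N` with `N` living below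
`deg x`. By adjunction these are morphisms from `N` to the restriction of `Δ_y`. They vanish when
`deg x ≤ deg y`, because `Δ_y` is zero in degrees below `deg y`.

The right-hand statements on End, Hom and Ext are the left-hand ones for the opposite category, in
which `C⁺` and `C⁻` change places. The description of `Δ^x` as an induced module is checked
directly, as the two tensor factors occur in the other order. -/

namespace LinReedy

/-! ## Pointwise criteria in the category of modules -/

section Pointwise

variable {k : Type u} [CommRing k] {D : Type u} [SmallCategory D] [Preadditive D] [Linear k D]

/-- The action of a morphism on a module. -/
abbrev act (M : LMod k D) {x y : D} (f : x ⟶ y) : M.obj.obj x →ₗ[k] M.obj.obj y :=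
  (M.obj.map f).hom

/-- The components of a morphism of modules. -/
abbrev comps {M N : LMod k D} (φ : M ⟶ N) (x : D) : M.obj.obj x →ₗ[k] N.obj.obj x :=
  (φ.hom.app x).hom

lemma act_id (M : LMod k D) (x : D) (m : M.obj.obj x) : act M (𝟙 x) m = m := by
  simp [act]

lemma act_comp (M : LMod k D) {x y z : D} (f : x ⟶ y) (g : y ⟶ z) (m : M.obj.obj x) :
    act M (f ≫ g) m = act M g (act M f m) := by
  simp [act]

lemma act_add (M : LMod k D) {x y : D} (f g : x ⟶ y) (m : M.obj.obj x) :
    act M (f + g) m = act M f m + act M g m := by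
  have := M.property.1
  simp [act, Functor.map_add]

lemma act_smul (M : LMod k D) {x y : D} (r : k) (f : x ⟶ y) (m : M.obj.obj x) :
    act M (r • f) m = r • act M f m := by
  have := M.property.1
  have := M.property.2
  simp [act, Functor.map_smul]

lemma comps_act {M N : LMod k D} (φ : M ⟶ N) {x y : D} (f : x ⟶ y) (m : M.obj.obj x) :
    comps φ y (act M f m) = act N f (comps φ x m) :=
  ConcreteCategory.congr_hom (φ.hom.naturality f) m

lemma comps_comp {M N L : LMod k D} (φ : M ⟶ N) (ψ : N ⟶ L) (x : D) (m : M.obj.obj x) :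
    comps (φ ≫ ψ) x m = comps ψ x (comps φ x m) := rfl

lemma comps_id (M : LMod k D) (x : D) (m : M.obj.obj x) : comps (𝟙 M) x m = m := rfl

lemma hom_ext_comps {M N : LMod k D} {φ ψ : M ⟶ N}
    (h : ∀ x (m : M.obj.obj x), comps φ x m = comps ψ x m) : φ = ψ := by
  refine ObjectProperty.hom_ext _ ?_
  ext x m
  exact h x m

/-- A morphism of modules from a natural family of linear maps. -/
def homOfComps {M N : LMod k D} (φ : ∀ x, M.obj.obj x →ₗ[k] N.obj.obj x)
    (h : ∀ {x y : D} (f : x ⟶ y) (m : M.obj.obj x), φ y (act M f m) = act N f (φ x m)) : M ⟶ N :=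
  ObjectProperty.homMk
    { app := fun x => ModuleCat.ofHom (φ x)
      naturality := fun x y f => by
        ext m
        exact h f m }

variable (k D) in
/-- Evaluation at an object. -/
abbrev evalAt (x : D) : LMod k D ⥤ ModuleCat.{u} k :=
  (isLinear k D).ι ⋙ (evaluation D (ModuleCat.{u} k)).obj x

instance : (isLinear k D).ι.Additive where
  map_add := rfl

instance (x : D) : (evalAt k D x).Additive where
  map_add := rfl

/-- Linear functors are closed under kernels, cokernels and finite products among all functors, so
finite limits and colimits are computed pointwise, as in the functor category. -/
instance (x : D) : PreservesFiniteLimits (evalAt k D x) := by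
  have : PreservesFiniteLimits (isLinear k D).ι := by
    have := fun {X Y : LMod k D} (f : X ⟶ Y) => (isLinear k D).preservesKernels_ι f
    exact Functor.preservesFiniteLimits_of_preservesKernels _
  exact comp_preservesFiniteLimits _ _

instance (x : D) : PreservesFiniteColimits (evalAt k D x) := by
  have : PreservesFiniteColimits (isLinear k D).ι := by
    have := fun {X Y : LMod k D} (f : X ⟶ Y) => (isLinear k D).preservesCokernels_ι f
    exact Functor.preservesFiniteColimits_of_preservesCokernels _
  exact comp_preservesFiniteColimits _ _

lemma comps_surjective_of_epi {M N : LMod k D} (φ : M ⟶ N) [Epi φ] (x : D) :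
    Function.Surjective (comps φ x) :=
  (ModuleCat.epi_iff_surjective _).1 (inferInstanceAs (Epi ((evalAt k D x).map φ)))

lemma comps_injective_of_mono {M N : LMod k D} (φ : M ⟶ N) [Mono φ] (x : D) :
    Function.Injective (comps φ x) :=
  (ModuleCat.mono_iff_injective _).1 (inferInstanceAs (Mono ((evalAt k D x).map φ)))

lemma epi_of_comps_surjective {M N : LMod k D} (φ : M ⟶ N)
    (h : ∀ x, Function.Surjective (comps φ x)) : Epi φ where
  left_cancellation a b hab := hom_ext_comps fun x n => by
    obtain ⟨m, rfl⟩ := h x n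
    rw [← comps_comp, hab, comps_comp]

lemma mono_of_comps_injective {M N : LMod k D} (φ : M ⟶ N)
    (h : ∀ x, Function.Injective (comps φ x)) : Mono φ where
  right_cancellation a b hab := hom_ext_comps fun x n => h x (by
    rw [← comps_comp, hab, comps_comp])

lemma isZero_of_subsingleton {M : LMod k D} (h : ∀ x, Subsingleton (M.obj.obj x)) : IsZero M := by
  rw [IsZero.iff_id_eq_zero]
  exact hom_ext_comps fun x m => Subsingleton.elim _ _

/-- Evaluation is exact and so commutes with homology, and a module is zero as soon as all its
values are. -/
lemma exact_of_comps (S : ShortComplex (LMod k D))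
    (h : ∀ x (m : S.X₂.obj.obj x), comps S.g x m = 0 → ∃ l, comps S.f x l = m) : S.Exact := by
  rw [ShortComplex.exact_iff_isZero_homology]
  refine isZero_of_subsingleton fun x => ?_
  have e : (S.map (evalAt k D x)).Exact := by
    rw [ShortComplex.moduleCat_exact_iff]
    exact h x
  rw [ShortComplex.exact_iff_isZero_homology] at e
  exact ModuleCat.subsingleton_of_isZero (e.of_iso (S.mapHomologyIso (evalAt k D x)).symm)

lemma exists_of_exact (S : ShortComplex (LMod k D)) (hS : S.Exact) (x : D) (m : S.X₂.obj.obj x)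
    (hm : comps S.g x m = 0) : ∃ l, comps S.f x l = m := by
  have e := hS.map (evalAt k D x)
  rw [ShortComplex.moduleCat_exact_iff] at e
  exact e m hm

end Pointwise

/-! ## Free modules -/

section Free

variable {k : Type u} [CommRing k] {D : Type u} [SmallCategory D] [Preadditive D] [Linear k D]
variable {S : Type u} (z : S → D)

variable (k) in
/-- The direct sum of the representable left modules `D(z s, -)`. -/
def freeMod : LMod k D where
  obj :=
    { obj := fun w => ModuleCat.of k (⨁ s : S, (z s ⟶ w))
      map := fun f => ModuleCat.ofHom (DirectSum.lmap fun s => Linear.rightComp k (z s) f)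
      map_id := fun w => ModuleCat.hom_ext <| LinearMap.ext fun t => DFinsupp.ext fun _ =>
        Category.comp_id _
      map_comp := fun f g => ModuleCat.hom_ext <| LinearMap.ext fun t => DFinsupp.ext fun _ =>
        (Category.assoc _ f g).symm }
  property := by
    refine ⟨⟨fun {_ _ a b} => ?_⟩, ⟨fun {_ _} a r => ?_⟩⟩
    · exact ModuleCat.hom_ext <| LinearMap.ext fun t => DFinsupp.ext fun _ =>
        Preadditive.comp_add _ _ _ _ a b
    · exact ModuleCat.hom_ext <| LinearMap.ext fun t => DFinsupp.ext fun _ =>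
        Linear.comp_smul _ _ _ _ r a

open scoped Classical in
/-- The inclusion of a summand of a free module. -/
def freeIn (w : D) (s : S) : (z s ⟶ w) →ₗ[k] (freeMod k z).obj.obj w :=
  DirectSum.lof k S (fun s => (z s ⟶ w)) s

open scoped Classical in
/-- A linear map out of a value of a free module. -/
def freeLift (w : D) {V : Type*} [AddCommGroup V] [Module k V] (φ : ∀ s, (z s ⟶ w) →ₗ[k] V) :
    (freeMod k z).obj.obj w →ₗ[k] V :=
  DirectSum.toModule k S V φ

/-- The coordinate of an element of a free module. -/
def freeCoord (w : D) (s : S) : (freeMod k z).obj.obj w →ₗ[k] (z s ⟶ w) :=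
  DirectSum.component k S (fun s => (z s ⟶ w)) s

variable {z}

lemma freeLift_freeIn (w : D) {V : Type*} [AddCommGroup V] [Module k V]
    (φ : ∀ s, (z s ⟶ w) →ₗ[k] V) (s : S) (h : z s ⟶ w) :
    freeLift z w φ (freeIn z w s h) = φ s h := by
  classical
  exact DirectSum.toModule_lof (M := fun s => (z s ⟶ w)) k s h

lemma free_linear_ext {w : D} {V : Type*} [AddCommGroup V] [Module k V]
    {φ ψ : (freeMod k z).obj.obj w →ₗ[k] V}
    (h : ∀ s f, φ (freeIn z w s f) = ψ (freeIn z w s f)) : φ = ψ := by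
  classical
  exact DirectSum.linearMap_ext (M := fun s => (z s ⟶ w)) k fun s => LinearMap.ext fun f => h s f

lemma freeCoord_freeIn_self (w : D) (s : S) (h : z s ⟶ w) :
    freeCoord (k := k) z w s (freeIn z w s h) = h := by
  classical
  exact DirectSum.component.lof_self (M := fun s => (z s ⟶ w)) k s h

lemma free_ext_coord {w : D} {a b : (freeMod k z).obj.obj w}
    (h : ∀ s, freeCoord z w s a = freeCoord z w s b) : a = b :=
  DFinsupp.ext fun s => h s

lemma act_freeIn {w w' : D} (f : w ⟶ w') (s : S) (h : z s ⟶ w) :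
    act (freeMod k z) f (freeIn z w s h) = freeIn z w' s (h ≫ f) := by
  classical
  exact DirectSum.lmap_lof _ _ _

/-- Evaluation at an element of a module, as a linear map on morphisms. -/
def actOn (N : LMod k D) {x : D} (n : N.obj.obj x) (y : D) : (x ⟶ y) →ₗ[k] N.obj.obj y where
  toFun h := act N h n
  map_add' f g := act_add N f g n
  map_smul' r f := act_smul N r f n

lemma actOn_apply (N : LMod k D) {x : D} (n : N.obj.obj x) {y : D} (f : x ⟶ y) :
    actOn N n y f = act N f n := rfl

/-- The morphism out of a free module given by the images of the generators. -/
def freeDesc {N : LMod k D} (n : ∀ s, N.obj.obj (z s)) : freeMod k z ⟶ N :=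
  homOfComps (fun w => freeLift z w fun s => actOn N (n s) w) fun {x y} f m => by
    refine LinearMap.congr_fun (f := (freeLift z y fun s => actOn N (n s) y) ∘ₗ
      act (freeMod k z) f) (g := act N f ∘ₗ freeLift z x fun s => actOn N (n s) x)
      (free_linear_ext fun s h => ?_) m
    rw [LinearMap.comp_apply, LinearMap.comp_apply, act_freeIn, freeLift_freeIn, freeLift_freeIn]
    exact act_comp N h f (n s)

lemma freeDesc_freeIn {N : LMod k D} (n : ∀ s, N.obj.obj (z s)) (w : D) (s : S) (h : z s ⟶ w) :
    comps (freeDesc n) w (freeIn z w s h) = act N h (n s) :=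
  freeLift_freeIn _ _ _ _

lemma free_hom_ext {N : LMod k D} {φ ψ : freeMod k z ⟶ N}
    (h : ∀ s, comps φ (z s) (freeIn z _ s (𝟙 (z s))) = comps ψ (z s) (freeIn z _ s (𝟙 (z s)))) :
    φ = ψ := by
  refine hom_ext_comps fun w m => LinearMap.congr_fun (f := comps φ w) (g := comps ψ w)
    (free_linear_ext fun s f => ?_) m
  rw [← Category.id_comp f, ← act_freeIn, comps_act, comps_act, h]

/-- By Yoneda a morphism out of a free module is a free choice of images of the generators, and
these lift along a pointwise surjection. -/
instance freeMod_projective : Projective (freeMod k z) where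
  factors {E X} f e _ := by
    choose p hp using fun s => comps_surjective_of_epi e (z s)
      (comps f (z s) (freeIn z _ s (𝟙 (z s))))
    refine ⟨freeDesc p, free_hom_ext fun s => ?_⟩
    rw [comps_comp, freeDesc_freeIn, act_id, hp]

end Free

/-! ### Free covers and their splittings -/

section Cover

variable {k : Type u} [CommRing k] {D : Type u} [SmallCategory D] [Preadditive D] [Linear k D]

/-- The nonzero elements of a module. -/
abbrev NonzeroElt (N : LMod k D) : Type u := Σ x : D, { n : N.obj.obj x // n ≠ 0 }

/-- The free module on the nonzero elements of a module covers it. -/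
def coverMap (N : LMod k D) : freeMod k (fun s : NonzeroElt N => s.1) ⟶ N :=
  freeDesc fun s => s.2.1

lemma coverMap_surjective (N : LMod k D) (x : D) : Function.Surjective (comps (coverMap N) x) := by
  intro n
  -- Zero is not among the generators. Leaving it out keeps all generators at objects where the
  -- module is nonzero, which controls the support of the cover.
  by_cases hn : n = 0
  · exact ⟨0, by rw [map_zero, hn]⟩
  · refine ⟨freeIn (fun s : NonzeroElt N => s.1) x ⟨x, n, hn⟩ (𝟙 x), ?_⟩
    exact (freeDesc_freeIn _ _ _ _).trans (act_id _ _ _)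

/-- The form in which projectivity is used below: the module is a retract of an explicit free
module. -/
lemma exists_section_of_projective (N : LMod k D) [Projective N] :
    ∃ σ : N ⟶ freeMod k (fun s : NonzeroElt N => s.1), σ ≫ coverMap N = 𝟙 N := by
  have := epi_of_comps_surjective _ (coverMap_surjective N)
  exact ⟨Projective.factorThru (𝟙 N) (coverMap N), Projective.factorThru_comp _ _⟩

end Cover

/-! ## Tensor products with projective modules -/

section TensorElements

variable {k : Type u} [CommRing k] {D : Type u} [SmallCategory D]

open scoped Classical in
/-- The pure tensors in `N ⊗_D M`. -/
def pureTensor (N : Dᵒᵖ ⥤ ModuleCat.{u} k) (M : D ⥤ ModuleCat.{u} k) (z : D) :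
    N.obj (op z) →ₗ[k] M.obj z →ₗ[k] tensorOver N M :=
  (TensorProduct.mk k (N.obj (op z)) (M.obj z)).compr₂ ((tensorRel N M).mkQ ∘ₗ
    DirectSum.lof k D (fun z => (N.obj (op z) ⊗[k] M.obj z)) z)

variable {N N' : Dᵒᵖ ⥤ ModuleCat.{u} k} {M M' : D ⥤ ModuleCat.{u} k}

lemma pureTensor_balanced {z w : D} (a : z ⟶ w) (n : N.obj (op w)) (m : M.obj z) :
    pureTensor N M z (N.map a.op n) m = pureTensor N M w n (M.map a m) := by
  refine (Submodule.Quotient.eq _).2 (Submodule.subset_span ⟨z, w, a, n, m, ?_⟩)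
  rfl

lemma tensorMap_pureTensor (φ : N ⟶ N') (ψ : M ⟶ M') (z : D) (n : N.obj (op z)) (m : M.obj z) :
    tensorMap φ ψ (pureTensor N M z n m) =
      pureTensor N' M' z ((φ.app (op z)).hom n) ((ψ.app z).hom m) := by
  classical
  refine (Eq.trans ?_ (tensorMap_mk φ ψ z n m)).trans ?_
  · unfold pureTensor
    simp only [LinearMap.compr₂_apply, TensorProduct.mk_apply, LinearMap.comp_apply]
  · unfold pureTensor
    simp only [LinearMap.compr₂_apply, TensorProduct.mk_apply, LinearMap.comp_apply]

lemma tensor_linear_ext {P : Type u} [AddCommGroup P] [Module k P] {f g : tensorOver N M →ₗ[k] P}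
    (h : ∀ z n m, f (pureTensor N M z n m) = g (pureTensor N M z n m)) : f = g := by
  classical
  refine tensorOver_hom_ext fun z n m => (Eq.trans ?_ (h z n m)).trans ?_
  · unfold pureTensor
    simp only [LinearMap.compr₂_apply, TensorProduct.mk_apply, LinearMap.comp_apply]
  · unfold pureTensor
    simp only [LinearMap.compr₂_apply, TensorProduct.mk_apply, LinearMap.comp_apply]

open scoped Classical in
/-- The linear map out of a tensor product given by a balanced family of bilinear maps. -/
def tensorLift {P : Type u} [AddCommGroup P] [Module k P]
    (B : ∀ z : D, N.obj (op z) →ₗ[k] M.obj z →ₗ[k] P)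
    (hB : ∀ {z w : D} (a : z ⟶ w) (n : N.obj (op w)) (m : M.obj z),
      B z (N.map a.op n) m = B w n (M.map a m)) : tensorOver N M →ₗ[k] P :=
  (tensorRel N M).liftQ (DirectSum.toModule k D P fun z => TensorProduct.lift (B z)) (by
    unfold tensorRel
    rw [Submodule.span_le]
    rintro _ ⟨z, w, a, n, m, rfl⟩
    rw [SetLike.mem_coe, LinearMap.mem_ker, map_sub, sub_eq_zero, DirectSum.toModule_lof,
      DirectSum.toModule_lof]
    exact hB a n m)

lemma tensorLift_pureTensor {P : Type u} [AddCommGroup P] [Module k P]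
    (B : ∀ z : D, N.obj (op z) →ₗ[k] M.obj z →ₗ[k] P)
    (hB : ∀ {z w : D} (a : z ⟶ w) (n : N.obj (op w)) (m : M.obj z),
      B z (N.map a.op n) m = B w n (M.map a m)) (z : D) (n : N.obj (op z)) (m : M.obj z) :
    tensorLift B hB (pureTensor N M z n m) = B z n m := by
  unfold tensorLift pureTensor
  simp only [LinearMap.compr₂_apply, LinearMap.comp_apply, Submodule.mkQ_apply,
    Submodule.liftQ_apply, DirectSum.toModule_lof, TensorProduct.mk_apply, TensorProduct.lift.tmul]

end TensorElements

/-! ### Exactness of the tensor product with a projective right module -/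

section TensorProjective

variable {k : Type u} [CommRing k] {D : Type u} [SmallCategory D] [Preadditive D] [Linear k D]
variable (N : RMod k D)

/-- The values of a left module at the objects that carry the nonzero elements of `N`. -/
abbrev CoordSum (M : LMod k D) : Type u := ⨁ s : NonzeroElt N, M.obj.obj s.1.unop

variable {N}

lemma map_op_eq_act {z w : D} (a : z ⟶ w) (n : N.obj.obj (op w)) :
    (N.obj.map a.op) n = act N a.op n := rfl

open scoped Classical in
/-- The coordinates of a pure tensor, depending linearly on the element of the free module. -/
def coordTensor (M : LMod k D) (x : D) :
    (freeMod k (fun s : NonzeroElt N => s.1)).obj.obj (op x) →ₗ[k]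
      M.obj.obj x →ₗ[k] CoordSum N M :=
  freeLift _ _ fun s => LinearMap.mk₂ k
    (fun a m => DirectSum.lof k _ (fun s : NonzeroElt N => M.obj.obj s.1.unop) s (act M a.unop m))
    (fun a b m => by rw [← map_add]; exact congrArg _ (act_add M a.unop b.unop m))
    (fun r a m => by rw [← map_smul]; exact congrArg _ (act_smul M r a.unop m))
    (fun a m m' => by rw [← map_add, ← map_add])
    (fun r a m => by rw [← map_smul, ← map_smul])

open scoped Classical in
lemma coordTensor_freeIn (M : LMod k D) (x : D) (s : NonzeroElt N) (a : s.1 ⟶ op x)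
    (m : M.obj.obj x) : coordTensor M x (freeIn _ _ s a) m =
      DirectSum.lof k _ (fun s : NonzeroElt N => M.obj.obj s.1.unop) s (act M a.unop m) := by
  unfold coordTensor
  rw [freeLift_freeIn]
  rfl

/-- The balancing relation, which makes the coordinates well defined on the tensor product. On a
generator both sides apply to `m` the composite of `b` and `a.unop`. -/
lemma coordTensor_act (M : LMod k D) {x y : D} (b : x ⟶ y)
    (t : (freeMod k (fun s : NonzeroElt N => s.1)).obj.obj (op y)) (m : M.obj.obj x) :
    coordTensor M x (act _ b.op t) m = coordTensor M y t (act M b m) := by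
  refine LinearMap.congr_fun (f := (coordTensor M x).flip m ∘ₗ act _ b.op)
    (g := (coordTensor M y).flip (act M b m)) (free_linear_ext fun s a => ?_) t
  simp only [LinearMap.comp_apply, LinearMap.flip_apply]
  rw [act_freeIn, coordTensor_freeIn, coordTensor_freeIn, unop_comp, Quiver.Hom.unop_op, act_comp]

open scoped Classical in
/-- The tensor with given coordinates. -/
def tensorOfCoord (M : LMod k D) : CoordSum N M →ₗ[k] tensorOver N.obj M.obj :=
  DirectSum.toModule k _ _ fun s => pureTensor N.obj M.obj s.1.unop s.2.1

lemma tensorOfCoord_coordTensor (M : LMod k D) {x : D}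
    (t : (freeMod k (fun s : NonzeroElt N => s.1)).obj.obj (op x)) (m : M.obj.obj x) :
    tensorOfCoord M (coordTensor M x t m) =
      pureTensor N.obj M.obj x (comps (coverMap N) (op x) t) m := by
  classical
  refine LinearMap.congr_fun (f := tensorOfCoord M ∘ₗ (coordTensor M x).flip m)
    (g := (pureTensor N.obj M.obj x).flip m ∘ₗ comps (coverMap N) (op x))
    (free_linear_ext fun s a => ?_) t
  simp only [LinearMap.comp_apply, LinearMap.flip_apply]
  rw [coordTensor_freeIn]
  unfold tensorOfCoord coverMap
  rw [DirectSum.toModule_lof, freeDesc_freeIn]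
  exact (pureTensor_balanced a.unop s.2.1 m).symm

lemma coordTensor_comps_balanced (σ : N ⟶ freeMod k (fun s : NonzeroElt N => s.1)) (M : LMod k D)
    {z w : D} (a : z ⟶ w) (n : N.obj.obj (op w)) (m : M.obj.obj z) :
    (coordTensor M z ∘ₗ comps σ (op z)) (N.obj.map a.op n) m =
      (coordTensor M w ∘ₗ comps σ (op w)) n (M.obj.map a m) := by
  rw [map_op_eq_act, LinearMap.comp_apply, comps_act, coordTensor_act]
  rfl

/-- The coordinates of a tensor with respect to a section of the free cover. -/
def tensorCoord (σ : N ⟶ freeMod k (fun s : NonzeroElt N => s.1)) (M : LMod k D) :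
    tensorOver N.obj M.obj →ₗ[k] CoordSum N M :=
  tensorLift (fun x => coordTensor M x ∘ₗ comps σ (op x)) (coordTensor_comps_balanced σ M)

lemma tensorCoord_pureTensor (σ : N ⟶ freeMod k (fun s : NonzeroElt N => s.1)) (M : LMod k D)
    (x : D) (n : N.obj.obj (op x)) (m : M.obj.obj x) :
    tensorCoord σ M (pureTensor N.obj M.obj x n m) = coordTensor M x (comps σ (op x) n) m :=
  tensorLift_pureTensor _ (coordTensor_comps_balanced σ M) _ _ _

/-- Together with the two naturality lemmas below, this exhibits `N ⊗ -` as a natural retract of the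
exact functor sending `M` to the direct sum of the values `M(z_s)`. Exactness passes to retracts. -/
lemma tensorOfCoord_tensorCoord {σ : N ⟶ freeMod k (fun s : NonzeroElt N => s.1)}
    (hσ : σ ≫ coverMap N = 𝟙 N) (M : LMod k D) (t : tensorOver N.obj M.obj) :
    tensorOfCoord M (tensorCoord σ M t) = t := by
  refine LinearMap.congr_fun (f := tensorOfCoord M ∘ₗ tensorCoord σ M) (g := LinearMap.id)
    (tensor_linear_ext fun x n m => ?_) t
  rw [LinearMap.comp_apply, tensorCoord_pureTensor, tensorOfCoord_coordTensor, ← comps_comp, hσ]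
  rfl

/-- Functoriality of `CoordSum`. -/
def coordMap (N : RMod k D) {M M' : LMod k D} (ψ : M ⟶ M') : CoordSum N M →ₗ[k] CoordSum N M' :=
  DirectSum.lmap fun s => comps ψ s.1.unop

lemma tensorCoord_natural (σ : N ⟶ freeMod k (fun s : NonzeroElt N => s.1)) {M M' : LMod k D}
    (ψ : M ⟶ M') (t : tensorOver N.obj M.obj) :
    tensorCoord σ M' (tensorMap (𝟙 N.obj) ψ.hom t) = coordMap N ψ (tensorCoord σ M t) := by
  classical
  refine LinearMap.congr_fun (f := tensorCoord σ M' ∘ₗ tensorMap (𝟙 N.obj) ψ.hom)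
    (g := coordMap N ψ ∘ₗ tensorCoord σ M) (tensor_linear_ext fun x n m => ?_) t
  rw [LinearMap.comp_apply, LinearMap.comp_apply, tensorMap_pureTensor, tensorCoord_pureTensor,
    tensorCoord_pureTensor]
  change coordTensor M' x (comps σ (op x) n) (comps ψ x m) = _
  generalize comps σ (op x) n = p
  refine LinearMap.congr_fun (f := (coordTensor M' x).flip (comps ψ x m))
    (g := coordMap N ψ ∘ₗ (coordTensor M x).flip m) (free_linear_ext fun s a => ?_) p
  simp only [LinearMap.comp_apply, LinearMap.flip_apply]
  rw [coordTensor_freeIn, coordTensor_freeIn]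
  unfold coordMap
  rw [DirectSum.lmap_lof, comps_act]

lemma tensorOfCoord_natural {M M' : LMod k D} (ψ : M ⟶ M') (t : CoordSum N M) :
    tensorMap (𝟙 N.obj) ψ.hom (tensorOfCoord M t) = tensorOfCoord M' (coordMap N ψ t) := by
  classical
  refine LinearMap.congr_fun (f := tensorMap (𝟙 N.obj) ψ.hom ∘ₗ tensorOfCoord M)
    (g := tensorOfCoord M' ∘ₗ coordMap N ψ)
    (DirectSum.linearMap_ext _ fun s => LinearMap.ext fun m => ?_) t
  unfold tensorOfCoord coordMap
  simp only [LinearMap.comp_apply]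
  rw [DirectSum.lmap_lof, DirectSum.toModule_lof, DirectSum.toModule_lof, tensorMap_pureTensor]
  rfl

variable [Projective N]

lemma tensorMap_injective {M M' : LMod k D} (ψ : M ⟶ M')
    (hψ : ∀ x, Function.Injective (comps ψ x)) :
    Function.Injective (tensorMap (𝟙 N.obj) ψ.hom) := by
  obtain ⟨σ, hσ⟩ := exists_section_of_projective N
  intro a b hab
  have h := congrArg (tensorCoord σ M') hab
  rw [tensorCoord_natural, tensorCoord_natural] at h
  rw [← tensorOfCoord_tensorCoord hσ M a, ← tensorOfCoord_tensorCoord hσ M b,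
    (DirectSum.lmap_injective _).2 (fun s => hψ _) h]

lemma tensorMap_surjective {M M' : LMod k D} (ψ : M ⟶ M')
    (hψ : ∀ x, Function.Surjective (comps ψ x)) :
    Function.Surjective (tensorMap (𝟙 N.obj) ψ.hom) := by
  obtain ⟨σ, hσ⟩ := exists_section_of_projective N
  intro b
  obtain ⟨a, ha⟩ := (DirectSum.lmap_surjective _).2 (fun s => hψ s.1.unop) (tensorCoord σ M' b)
  exact ⟨tensorOfCoord M a,
    (tensorOfCoord_natural ψ a).trans ((congrArg _ ha).trans (tensorOfCoord_tensorCoord hσ M' b))⟩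

/-- Exactness is read off on coordinates: a direct sum of exact sequences is exact, and the
retraction carries a preimage of the coordinates to a preimage of the tensor. -/
lemma tensorMap_exact {L M M' : LMod k D} (φ : L ⟶ M) (ψ : M ⟶ M')
    (h : ∀ x m, comps ψ x m = 0 → ∃ l, comps φ x l = m) (t : tensorOver N.obj M.obj)
    (ht : tensorMap (𝟙 N.obj) ψ.hom t = 0) : ∃ l, tensorMap (𝟙 N.obj) φ.hom l = t := by
  classical
  obtain ⟨σ, hσ⟩ := exists_section_of_projective N
  have h1 : coordMap N ψ (tensorCoord σ M t) = 0 := by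
    rw [← tensorCoord_natural, ht, map_zero]
  have h2 : tensorCoord σ M t ∈ LinearMap.range (coordMap N φ) := by
    unfold coordMap
    -- Only finitely many coordinates are nonzero, so it suffices to lift each of them separately.
    rw [← DirectSum.sum_support_of (tensorCoord σ M t)]
    refine Submodule.sum_mem _ fun s _ => ?_
    obtain ⟨l, hl⟩ := h s.1.unop (tensorCoord σ M t s) (DFinsupp.ext_iff.1 h1 s)
    exact ⟨DirectSum.lof k _ (fun s : NonzeroElt N => L.obj.obj s.1.unop) s l, by
      rw [DirectSum.lmap_lof, hl]; rfl⟩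
  obtain ⟨l, hl⟩ := h2
  exact ⟨tensorOfCoord L l, by rw [tensorOfCoord_natural, hl, tensorOfCoord_tensorCoord hσ]⟩

end TensorProjective

/-! ## Induction from a subcategory -/

section Induction

variable {k : Type u} [CommRing k] {C : Type u} [SmallCategory C] [Preadditive C] [Linear k C]

/-- Dimension shifting: in the long exact sequence `Extⁿ⁺¹(X₃, Y)` lies between `Extⁿ(X₁, Y)` and
`Extⁿ⁺¹(X₂, Y)`, and the latter vanishes because `X₂` is projective. -/
lemma subsingleton_ext_succ {T : ShortComplex (LMod k C)} (hT : T.ShortExact)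
    (hP : Projective T.X₂) (Y : LMod k C) (n : ℕ) (h : Subsingleton (Abelian.Ext T.X₁ Y n)) :
    Subsingleton (Abelian.Ext T.X₃ Y (n + 1)) := by
  refine subsingleton_of_forall_eq 0 fun e => ?_
  obtain ⟨a, ha⟩ := Abelian.Ext.contravariant_sequence_exact₃ hT Y e
    (Abelian.Ext.eq_zero_of_projective _) (add_comm 1 n)
  rw [← ha, Subsingleton.elim a 0, Abelian.Ext.comp_zero]

/-! ### The adjunction between induction and restriction -/

namespace LinSub

variable (S : LinSub k C)

/-- The right `S`-module `C(-, y)`. -/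
def restrictedRep (y : C) : RMod k S.Obj where
  obj := S.incl.op ⋙ (linearYoneda k C).obj y
  property := by
    refine ⟨⟨fun {_ _ a b} => ?_⟩, ⟨fun {_ _} a r => ?_⟩⟩
    · ext h
      exact Preadditive.add_comp _ _ _ a.unop.1 b.unop.1 h
    · ext h
      exact Linear.smul_comp _ _ _ r a.unop.1 h

/-- The restriction of a left `C`-module to `S`. -/
def restrict (M : LMod k C) : LMod k S.Obj where
  obj := S.incl ⋙ M.obj
  property := by
    refine ⟨⟨fun {_ _ a b} => ?_⟩, ⟨fun {_ _} a r => ?_⟩⟩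
    · ext m
      exact act_add M a.1 b.1 m
    · ext m
      exact act_smul M r a.1 m

variable {S}

/-- The pure tensors in an induced module. -/
def indTensor (M : LMod k S.Obj) (y : C) (z : S.Obj) :
    (z.as ⟶ y) →ₗ[k] M.obj.obj z →ₗ[k] (S.inductionLeft M).obj.obj y :=
  pureTensor (S.restrictedRep y).obj M.obj z

lemma indTensor_balanced (M : LMod k S.Obj) (y : C) {z w : S.Obj} (a : z ⟶ w) (h : w.as ⟶ y)
    (m : M.obj.obj z) : indTensor M y z (a.1 ≫ h) m = indTensor M y w h (act M a m) :=
  pureTensor_balanced (N := (S.restrictedRep y).obj) a h m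

lemma act_indTensor (M : LMod k S.Obj) {y y' : C} (f : y ⟶ y') (z : S.Obj) (h : z.as ⟶ y)
    (m : M.obj.obj z) :
    act (S.inductionLeft M) f (indTensor M y z h m) = indTensor M y' z (h ≫ f) m :=
  tensorMap_pureTensor (Functor.whiskerLeft S.incl.op ((linearYoneda k C).map f)) (𝟙 M.obj) z h m

lemma ind_linear_ext {M : LMod k S.Obj} {y : C} {P : Type u} [AddCommGroup P] [Module k P]
    {f g : (S.inductionLeft M).obj.obj y →ₗ[k] P}
    (h : ∀ z a m, f (indTensor M y z a m) = g (indTensor M y z a m)) : f = g :=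
  tensor_linear_ext (N := (S.restrictedRep y).obj) h

/-- An induced module is generated by the tensors `1 ⊗ m`. -/
lemma ind_hom_ext {M : LMod k S.Obj} {Y : LMod k C} {φ ψ : S.inductionLeft M ⟶ Y}
    (h : ∀ (z : S.Obj) m, comps φ z.as (indTensor M z.as z (𝟙 _) m) =
      comps ψ z.as (indTensor M z.as z (𝟙 _) m)) : φ = ψ := by
  refine hom_ext_comps fun y m => LinearMap.congr_fun (f := comps φ y) (g := comps ψ y)
    (ind_linear_ext fun z a m => ?_) m
  rw [← Category.id_comp a, ← act_indTensor, comps_act, comps_act, h]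

/-- The components of a morphism to a restricted module. -/
def restrictComps {M : LMod k S.Obj} {Y : LMod k C} (g : M ⟶ S.restrict Y) (z : S.Obj) :
    M.obj.obj z →ₗ[k] Y.obj.obj z.as := comps g z

lemma restrictComps_act {M : LMod k S.Obj} {Y : LMod k C} (g : M ⟶ S.restrict Y) {z w : S.Obj}
    (a : z ⟶ w) (m : M.obj.obj z) :
    restrictComps g w (act M a m) = act Y a.1 (restrictComps g z m) :=
  comps_act g a m

/-- The action on the images of a morphism to a restricted module, as a bilinear map. -/
def actBilin {M : LMod k S.Obj} {Y : LMod k C} (g : M ⟶ S.restrict Y) (y : C) (z : S.Obj) :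
    (z.as ⟶ y) →ₗ[k] M.obj.obj z →ₗ[k] Y.obj.obj y :=
  LinearMap.mk₂ k (fun h m => act Y h (restrictComps g z m))
    (fun _ _ _ => act_add _ _ _ _) (fun _ _ _ => act_smul _ _ _ _)
    (fun h m m' => by rw [map_add]; exact map_add (act Y h) _ _)
    (fun r h m => by rw [map_smul]; exact map_smul (act Y h) _ _)

lemma actBilin_balanced {M : LMod k S.Obj} {Y : LMod k C} (g : M ⟶ S.restrict Y) (y : C)
    {z w : S.Obj} (a : z ⟶ w) (h : w.as ⟶ y) (m : M.obj.obj z) :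
    actBilin g y z (a.1 ≫ h) m = actBilin g y w h (act M a m) := by
  change act Y (a.1 ≫ h) (restrictComps g z m) = act Y h (restrictComps g w (act M a m))
  rw [restrictComps_act, act_comp]

/-- The linear map out of a value of an induced module given by a balanced family. -/
def indLift {M : LMod k S.Obj} {y : C} {P : Type u} [AddCommGroup P] [Module k P]
    (B : ∀ z : S.Obj, (z.as ⟶ y) →ₗ[k] M.obj.obj z →ₗ[k] P)
    (hB : ∀ {z w : S.Obj} (a : z ⟶ w) (h : w.as ⟶ y) (m : M.obj.obj z),
      B z (a.1 ≫ h) m = B w h (act M a m)) : (S.inductionLeft M).obj.obj y →ₗ[k] P :=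
  tensorLift (N := (S.restrictedRep y).obj) B hB

lemma indLift_indTensor {M : LMod k S.Obj} {y : C} {P : Type u} [AddCommGroup P] [Module k P]
    (B : ∀ z : S.Obj, (z.as ⟶ y) →ₗ[k] M.obj.obj z →ₗ[k] P)
    (hB : ∀ {z w : S.Obj} (a : z ⟶ w) (h : w.as ⟶ y) (m : M.obj.obj z),
      B z (a.1 ≫ h) m = B w h (act M a m)) (z : S.Obj) (h : z.as ⟶ y) (m : M.obj.obj z) :
    indLift B hB (indTensor M y z h m) = B z h m :=
  tensorLift_pureTensor (N := (S.restrictedRep y).obj) B hB z h m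

/-- The morphism out of an induced module that corresponds to a morphism to a restricted module. -/
def indDesc {M : LMod k S.Obj} {Y : LMod k C} (g : M ⟶ S.restrict Y) : S.inductionLeft M ⟶ Y :=
  homOfComps (fun y => indLift (actBilin g y) (actBilin_balanced g y)) fun {x y} f t => by
    refine LinearMap.congr_fun (f := indLift (actBilin g y) (actBilin_balanced g y) ∘ₗ act _ f)
      (g := act Y f ∘ₗ indLift (actBilin g x) (actBilin_balanced g x))
      (ind_linear_ext fun z a m => ?_) t
    rw [LinearMap.comp_apply, LinearMap.comp_apply, act_indTensor, indLift_indTensor,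
      indLift_indTensor]
    exact act_comp Y a f _

lemma indDesc_indTensor {M : LMod k S.Obj} {Y : LMod k C} (g : M ⟶ S.restrict Y) (y : C)
    (z : S.Obj) (h : z.as ⟶ y) (m : M.obj.obj z) :
    comps (indDesc g) y (indTensor M y z h m) = act Y h (restrictComps g z m) :=
  indLift_indTensor _ (actBilin_balanced g y) z h m

/-- The restriction of a morphism. -/
def restrictMap {Y Y' : LMod k C} (f : Y ⟶ Y') : S.restrict Y ⟶ S.restrict Y' :=
  homOfComps (M := S.restrict Y) (N := S.restrict Y') (fun z => comps f z.as)
    fun a m => comps_act f a.1 m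

/-- The morphism to a restricted module that corresponds to a morphism out of an induced module. -/
def indCurry {M : LMod k S.Obj} {Y : LMod k C} (f : S.inductionLeft M ⟶ Y) : M ⟶ S.restrict Y :=
  homOfComps (N := S.restrict Y)
    (fun z => comps f z.as ∘ₗ indTensor M z.as z (𝟙 _)) fun {z w} a m => by
    change comps f w.as (indTensor M w.as w (𝟙 _) (act M a m)) =
      act Y a.1 (comps f z.as (indTensor M z.as z (𝟙 _) m))
    rw [← indTensor_balanced, ← comps_act, act_indTensor, Category.comp_id, Category.id_comp]

/-- Induction is left adjoint to restriction, and restriction preserves epimorphisms since these are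
the pointwise surjections. A lift is found after restriction and carried back by `indDesc`. -/
instance induction_projective (M : LMod k S.Obj) [Projective M] :
    Projective (S.inductionLeft M) where
  factors {E X} f e _ := by
    have : Epi (restrictMap (S := S) e) :=
      epi_of_comps_surjective _ fun z => comps_surjective_of_epi e z.as
    refine ⟨indDesc (Projective.factorThru (indCurry f) (restrictMap (S := S) e)),
      ind_hom_ext fun z m => ?_⟩
    rw [comps_comp, indDesc_indTensor, act_id]
    change comps (restrictMap (S := S) e) z
      (comps (Projective.factorThru (indCurry f) (restrictMap (S := S) e)) z m) = _
    rw [← comps_comp, Projective.factorThru_comp]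
    rfl

/-- Functoriality of induction, on values. -/
def indMapAt {M M' : LMod k S.Obj} (ψ : M ⟶ M') (y : C) :
    (S.inductionLeft M).obj.obj y →ₗ[k] (S.inductionLeft M').obj.obj y :=
  tensorMap (𝟙 (S.restrictedRep y).obj) ψ.hom

lemma indMapAt_indTensor {M M' : LMod k S.Obj} (ψ : M ⟶ M') (y : C) (z : S.Obj) (h : z.as ⟶ y)
    (m : M.obj.obj z) :
    indMapAt ψ y (indTensor M y z h m) = indTensor M' y z h (comps ψ z m) :=
  tensorMap_pureTensor (𝟙 (S.restrictedRep y).obj) ψ.hom z h m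

/-- Functoriality of induction. -/
def indMap {M M' : LMod k S.Obj} (ψ : M ⟶ M') : S.inductionLeft M ⟶ S.inductionLeft M' :=
  homOfComps (indMapAt ψ) fun {x y} f t => by
    refine LinearMap.congr_fun (f := indMapAt ψ y ∘ₗ act (S.inductionLeft M) f)
      (g := act (S.inductionLeft M') f ∘ₗ indMapAt ψ x) (ind_linear_ext fun z a m => ?_) t
    rw [LinearMap.comp_apply, LinearMap.comp_apply, act_indTensor, indMapAt_indTensor,
      indMapAt_indTensor, act_indTensor]

lemma indMap_indTensor {M M' : LMod k S.Obj} (ψ : M ⟶ M') (y : C) (z : S.Obj) (h : z.as ⟶ y)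
    (m : M.obj.obj z) :
    comps (indMap ψ) y (indTensor M y z h m) = indTensor M' y z h (comps ψ z m) :=
  indMapAt_indTensor ψ y z h m

/-- The image of a short complex under induction. -/
def indComplex (T : ShortComplex (LMod k S.Obj)) : ShortComplex (LMod k C) :=
  ShortComplex.mk (indMap T.f) (indMap T.g) (ind_hom_ext fun z m => by
    rw [comps_comp, indMap_indTensor, indMap_indTensor, ← comps_comp, T.zero]
    exact map_zero _)

/-- By adjunction a morphism `Ind N ⟶ Y` is a morphism from `N` to the restriction of `Y`, and at
each object its source or its target is zero. -/
lemma subsingleton_hom_induction (N : LMod k S.Obj) (Y : LMod k C)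
    (h : ∀ z, Subsingleton (N.obj.obj z) ∨ Subsingleton (Y.obj.obj z.as)) :
    Subsingleton (S.inductionLeft N ⟶ Y) := by
  refine ⟨fun φ ψ => ind_hom_ext fun z m => ?_⟩
  rcases h z with h | h
  · rw [Subsingleton.elim m 0, map_zero, map_zero, map_zero]
  · exact Subsingleton.elim _ _

variable [∀ y, Projective (S.restrictedRep y)]

lemma indMapAt_injective {M M' : LMod k S.Obj} (ψ : M ⟶ M')
    (hψ : ∀ x, Function.Injective (comps ψ x)) (y : C) : Function.Injective (indMapAt ψ y) :=
  tensorMap_injective (N := S.restrictedRep y) ψ hψ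

lemma indMapAt_surjective {M M' : LMod k S.Obj} (ψ : M ⟶ M')
    (hψ : ∀ x, Function.Surjective (comps ψ x)) (y : C) : Function.Surjective (indMapAt ψ y) :=
  tensorMap_surjective (N := S.restrictedRep y) ψ hψ

lemma indMapAt_exact {L M M' : LMod k S.Obj} (φ : L ⟶ M) (ψ : M ⟶ M')
    (h : ∀ x m, comps ψ x m = 0 → ∃ l, comps φ x l = m) (y : C)
    (t : (S.inductionLeft M).obj.obj y) (ht : indMapAt ψ y t = 0) : ∃ l, indMapAt φ y l = t :=
  tensorMap_exact (N := S.restrictedRep y) φ ψ h t ht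

/-- The value of the induced module at `y` is the tensor product with the right `S`-module `C(-,
y)`, so projectivity of these modules makes induction exact. -/
lemma indComplex_shortExact (T : ShortComplex (LMod k S.Obj)) (hT : T.ShortExact) :
    (indComplex T).ShortExact := by
  have := hT.mono_f
  have := hT.epi_g
  have h1 : (indComplex T).Exact := exact_of_comps _ fun x m hm =>
    indMapAt_exact T.f T.g (exists_of_exact T hT.exact) x m hm
  have h2 : Mono (indComplex T).f := mono_of_comps_injective _
    (indMapAt_injective T.f (comps_injective_of_mono T.f))
  have h3 : Epi (indComplex T).g := epi_of_comps_surjective _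
    (indMapAt_surjective T.g (comps_surjective_of_epi T.g))
  exact { exact := h1, mono_f := h2, epi_g := h3 }

/-- Induction turns `0 ⟶ ker p ⟶ F ⟶ N ⟶ 0` into a short exact sequence with projective middle term,
along which dimensions are shifted. -/
lemma ext_induction_succ {F N : LMod k S.Obj} [Projective F] (p : F ⟶ N) [Epi p] (Y : LMod k C)
    (n : ℕ) (h : Subsingleton (Abelian.Ext (S.inductionLeft (kernel p)) Y n)) :
    Subsingleton (Abelian.Ext (S.inductionLeft N) Y (n + 1)) := by
  have hT : (ShortComplex.mk (kernel.ι p) p (kernel.condition p)).ShortExact :=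
    { exact := ShortComplex.exact_of_f_is_kernel _ (kernelIsKernel p) }
  exact subsingleton_ext_succ (indComplex_shortExact _ hT) (induction_projective F) Y n h

end LinSub

end Induction

/-! ## Quotients of representable modules -/

section QuotRep

variable {k : Type u} [CommRing k] {D : Type u} [SmallCategory D] [Preadditive D] [Linear k D]
variable {x : D} {J : ∀ y : D, Submodule k (x ⟶ y)}
variable (hJ : ∀ {y z : D} (f : x ⟶ y) (g : y ⟶ z), f ∈ J y → f ≫ g ∈ J z)

/-- The class of a morphism in a quotient of a representable module. -/
def quotMk (y : D) : (x ⟶ y) →ₗ[k] (quotRep x J hJ).obj.obj y := (J y).mkQ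

lemma quotMk_surjective (y : D) : Function.Surjective (quotMk hJ y) := (J y).mkQ_surjective

lemma quotMk_eq_zero_iff {y : D} {f : x ⟶ y} : quotMk hJ y f = 0 ↔ f ∈ J y :=
  Submodule.Quotient.mk_eq_zero _

lemma act_quotMk {y z : D} (f : x ⟶ y) (g : y ⟶ z) :
    act (quotRep x J hJ) g (quotMk hJ y f) = quotMk hJ z (f ≫ g) := rfl

lemma quot_hom_ext {N : LMod k D} {φ ψ : quotRep x J hJ ⟶ N}
    (h : comps φ x (quotMk hJ x (𝟙 x)) = comps ψ x (quotMk hJ x (𝟙 x))) : φ = ψ :=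
  hom_ext_comps fun y m => by
    obtain ⟨f, rfl⟩ := quotMk_surjective hJ y m
    rw [← Category.id_comp f, ← act_quotMk, comps_act, comps_act, h]

/-- The linear map out of a value of a quotient of a representable module. -/
def quotLift {V : Type u} [AddCommGroup V] [Module k V] (y : D) (φ : (x ⟶ y) →ₗ[k] V)
    (hφ : ∀ f ∈ J y, φ f = 0) : (quotRep x J hJ).obj.obj y →ₗ[k] V :=
  (J y).liftQ φ hφ

lemma quotLift_quotMk {V : Type u} [AddCommGroup V] [Module k V] (y : D) (φ : (x ⟶ y) →ₗ[k] V)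
    (hφ : ∀ f ∈ J y, φ f = 0) (f : x ⟶ y) : quotLift hJ y φ hφ (quotMk hJ y f) = φ f :=
  rfl

/-- The morphism out of a quotient of a representable module given by an annihilated element. -/
def quotDesc {N : LMod k D} (n : N.obj.obj x) (hn : ∀ y, ∀ f ∈ J y, actOn N n y f = 0) :
    quotRep x J hJ ⟶ N :=
  homOfComps (fun y => quotLift hJ y (actOn N n y) (hn y)) fun {y z} g m => by
    obtain ⟨f, rfl⟩ := quotMk_surjective hJ y m
    rw [act_quotMk, quotLift_quotMk, quotLift_quotMk]
    exact act_comp N f g n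

-- An equality of objects and not merely an isomorphism, so that right standard modules can be
-- replaced by left ones by rewriting.
variable {hJ} in
lemma quotRep_congr {J' : ∀ y : D, Submodule k (x ⟶ y)}
    {hJ' : ∀ {y z : D} (f : x ⟶ y) (g : y ⟶ z), f ∈ J' y → f ≫ g ∈ J' z}
    (h : ∀ y, J y = J' y) : quotRep x J hJ = quotRep x J' hJ' := by
  obtain rfl : J = J' := funext h
  rfl

end QuotRep

/-! ## Decomposition of morphisms in a Reedy category -/

namespace GenReedy

variable {k : Type u} [CommRing k] {C : Type u} [SmallCategory C] [Preadditive C] [Linear k C]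
variable (R : GenReedy k C)

/-- The universal property of the decomposition of the morphisms of a Reedy category. -/
lemma exists_lift {x y : C} {V : Type u} [AddCommGroup V] [Module k V]
    (B : ∀ z, R.plus.hom z y →ₗ[k] R.minus.hom x z →ₗ[k] V)
    (hB : ∀ (z : C) (a : z ⟶ z) (ha : a ∈ R.zero.hom z z) (f : R.plus.hom z y)
      (g : R.minus.hom x z), B z ⟨a ≫ f.1, R.plus.comp_mem ha.1 f.2⟩ g =
        B z f ⟨g.1 ≫ a, R.minus.comp_mem g.2 ha.2⟩) :
    ∃ L : (x ⟶ y) →ₗ[k] V, ∀ z (f : R.plus.hom z y) (g : R.minus.hom x z),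
      L (g.1 ≫ f.1) = B z f g := by
  classical
  have hle : ∀ z, balanced R.plus R.minus x y z ≤ LinearMap.ker (TensorProduct.lift (B z)) := by
    intro z
    refine Submodule.span_le.2 ?_
    rintro _ ⟨a, ha, f, g, rfl⟩
    rw [SetLike.mem_coe, LinearMap.mem_ker, map_sub, sub_eq_zero]
    exact hB z a ha f g
  let L' := DirectSum.toModule k C V fun z =>
    (balanced R.plus R.minus x y z).liftQ (TensorProduct.lift (B z)) (hle z)
  let e := LinearEquiv.ofBijective (rho R.plus R.minus x y) (R.rho_bijective x y)
  refine ⟨L' ∘ₗ e.symm.toLinearMap, fun z f g => ?_⟩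
  have h : e.symm (g.1 ≫ f.1) = DirectSum.lof k C (fun z => (R.plus.hom z y ⊗[k] R.minus.hom x z) ⧸
      balanced R.plus R.minus x y z) z (Submodule.Quotient.mk (f ⊗ₜ g)) := by
    rw [LinearEquiv.symm_apply_eq]
    change _ = rho R.plus R.minus x y _
    unfold rho
    erw [DirectSum.toModule_lof]
    rfl
  rw [LinearMap.comp_apply, LinearEquiv.coe_coe, h]
  erw [DirectSum.toModule_lof]
  rfl

lemma hom_linear_ext {x y : C} {V : Type*} [AddCommGroup V] [Module k V] {φ ψ : (x ⟶ y) →ₗ[k] V}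
    (h : ∀ z (g : x ⟶ z) (f : z ⟶ y), g ∈ R.minus.hom x z → f ∈ R.plus.hom z y →
      φ (g ≫ f) = ψ (g ≫ f)) : φ = ψ := by
  ext t
  refine LinearMap.eqOn_span (f := φ) (g := ψ) ?_ (R.mem_span x y t)
  rintro _ ⟨z, g, f, hg, hf, rfl⟩
  exact h z g f hg hf

/-- The sum of `C⁺(x, -)` and the ideal is direct: a morphism of `C⁺` starting at `x` lies in the
summand `z = x` of the decomposition, the ideal in the summands with `deg z < deg x`. -/
lemma eq_zero_of_mem_plus_of_mem_ideal {x y : C} {f : x ⟶ y} (hf : f ∈ R.plus.hom x y)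
    (hi : f ∈ R.ideal (R.deg x) x y) : f = 0 := by
  classical
  -- `L` is the projection of `C(x, y)` to the summand `z = x`, followed by composition. It fixes `f
  -- = f ∘ 𝟙` and kills the ideal.
  obtain ⟨L, hL⟩ := R.exists_lift (x := x) (y := y) (V := (x ⟶ y))
    (fun z => if z = x then LinearMap.mk₂ k (fun f g => g.1 ≫ f.1)
      (fun _ _ _ => Preadditive.comp_add _ _ _ _ _ _) (fun _ _ _ => Linear.comp_smul _ _ _ _ _ _)
      (fun _ _ _ => Preadditive.add_comp _ _ _ _ _ _) (fun _ _ _ => Linear.smul_comp _ _ _ _ _ _)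
      else 0) (fun z a ha f g => by
        split_ifs
        · exact (Category.assoc _ _ _).symm
        · rfl)
  have h1 : L f = f := by
    have := hL x ⟨f, hf⟩ ⟨𝟙 x, R.minus.id_mem x⟩
    simpa using this
  have h2 : R.ideal (R.deg x) x y ≤ LinearMap.ker L := by
    refine Submodule.span_le.2 ?_
    rintro _ ⟨z, g, f, hz, hg, hf, rfl⟩
    have hne : z ≠ x := by
      rintro rfl
      exact lt_irrefl _ hz
    have := hL z ⟨f, hf⟩ ⟨g, hg⟩
    rwa [if_neg hne] at this
  rw [← h1]
  exact h2 hi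

/-- In a composite `f ∘ g` with `g` nonzero in `C⁻(x, z)`, either `deg z < deg x` and the composite
is in the ideal, or `z = x` and `g` belongs to `A_x⁰`, hence to `C⁺`. -/
lemma exists_plus_sub_mem_ideal {x y : C} (h : x ⟶ y) :
    ∃ f ∈ R.plus.hom x y, h - f ∈ R.ideal (R.deg x) x y := by
  have key : h ∈ R.plus.hom x y ⊔ R.ideal (R.deg x) x y := by
    refine (Submodule.span_le.2 ?_) (R.mem_span x y h)
    rintro _ ⟨z, g, f, hg, hf, rfl⟩
    by_cases h0 : g = 0
    · rw [h0, zero_comp]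
      exact zero_mem _
    rcases R.minus_deg g hg h0 with rfl | hz
    · exact Submodule.mem_sup_left (R.plus.comp_mem (R.plus_self x ▸ hg) hf)
    · exact Submodule.mem_sup_right (Submodule.subset_span ⟨z, g, f, hz, hg, hf, rfl⟩)
  obtain ⟨f, hf, i, hi, rfl⟩ := Submodule.mem_sup.1 key
  exact ⟨f, hf, by rwa [add_sub_cancel_left]⟩

lemma mem_ideal_of_mem_minus {x z : C} {g : x ⟶ z} (hg : g ∈ R.minus.hom x z)
    {α : Ordinal.{u}} (hz : R.deg z < α) : g ∈ R.ideal α x z :=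
  Submodule.subset_span ⟨z, g, 𝟙 z, hz, hg, R.plus.id_mem z, (Category.comp_id g).symm⟩

/-! ## Left standard modules -/

/-- The class of a morphism in the left standard module. -/
def stdMk (x y : C) : (x ⟶ y) →ₗ[k] (R.stdLeft x).obj.obj y :=
  quotMk (fun f g hf => R.ideal_comp (R.deg x) f g hf) y

lemma stdMk_surjective (x y : C) : Function.Surjective (R.stdMk x y) :=
  quotMk_surjective (fun f g hf => R.ideal_comp (R.deg x) f g hf) y

lemma stdMk_eq_zero_iff {x y : C} {f : x ⟶ y} : R.stdMk x y f = 0 ↔ f ∈ R.ideal (R.deg x) x y :=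
  quotMk_eq_zero_iff (fun f g hf => R.ideal_comp (R.deg x) f g hf)

lemma std_hom_ext {x : C} {N : LMod k C} {φ ψ : R.stdLeft x ⟶ N}
    (h : comps φ x (R.stdMk x x (𝟙 x)) = comps ψ x (R.stdMk x x (𝟙 x))) : φ = ψ :=
  quot_hom_ext (fun f g hf => R.ideal_comp (R.deg x) f g hf) h

/-- The morphism out of the left standard module given by an annihilated element. -/
def stdDesc {x : C} {N : LMod k C} (n : N.obj.obj x)
    (hn : ∀ y, ∀ f ∈ R.ideal (R.deg x) x y, actOn N n y f = 0) : R.stdLeft x ⟶ N :=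
  quotDesc (fun f g hf => R.ideal_comp (R.deg x) f g hf) n hn

lemma stdDesc_stdMk {x : C} {N : LMod k C} (n : N.obj.obj x)
    (hn : ∀ y, ∀ f ∈ R.ideal (R.deg x) x y, actOn N n y f = 0) (y : C) (f : x ⟶ y) :
    comps (R.stdDesc n hn) y (R.stdMk x y f) = act N f n := rfl

/-- Every class has a representative in `C⁺(x, y)`, which is zero for such `y`. -/
lemma subsingleton_stdLeft {x y : C} (h : ¬ (x = y ∨ R.deg x < R.deg y)) :
    Subsingleton ((R.stdLeft x).obj.obj y) := by
  refine subsingleton_of_forall_eq 0 fun m => ?_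
  obtain ⟨t, rfl⟩ := R.stdMk_surjective x y m
  rw [stdMk_eq_zero_iff]
  obtain ⟨f, hf, hi⟩ := R.exists_plus_sub_mem_ideal t
  by_cases h0 : f = 0
  · rwa [h0, sub_zero] at hi
  · exact (h (R.plus_deg f hf h0)).elim

/-- A morphism is determined by the image of the generator, an element of the standard module of `y`
at `x`. -/
lemma eq_or_deg_lt_of_nontrivial_hom {x y : C} (h : Nontrivial (R.stdLeft x ⟶ R.stdLeft y)) :
    x = y ∨ R.deg y < R.deg x := by
  by_contra hxy
  have hs : Subsingleton ((R.stdLeft y).obj.obj x) :=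
    R.subsingleton_stdLeft fun h' => hxy (h'.imp Eq.symm id)
  obtain ⟨φ, ψ, hne⟩ := h
  exact hne (R.std_hom_ext (Subsingleton.elim _ _))

/-- The endomorphism of the left standard module given by an element of the local algebra. -/
def stdEnd (x : C) (a : x ⟶ x) : R.stdLeft x ⟶ R.stdLeft x :=
  R.stdDesc (R.stdMk x x a) fun _ f hf => R.stdMk_eq_zero_iff.2 (R.comp_ideal _ a f hf)

lemma stdEnd_stdMk (x : C) (a : x ⟶ x) (y : C) (f : x ⟶ y) :
    comps (R.stdEnd x a) y (R.stdMk x y f) = R.stdMk x y (a ≫ f) := rfl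

lemma stdEnd_add (x : C) (a b : x ⟶ x) : R.stdEnd x (a + b) = R.stdEnd x a + R.stdEnd x b :=
  R.std_hom_ext (by
    change _ = comps (R.stdEnd x a) x _ + comps (R.stdEnd x b) x _
    rw [stdEnd_stdMk, stdEnd_stdMk, stdEnd_stdMk, Preadditive.add_comp, map_add])

lemma stdEnd_smul (x : C) (r : k) (a : x ⟶ x) : R.stdEnd x (r • a) = r • R.stdEnd x a :=
  R.std_hom_ext (by
    change _ = r • comps (R.stdEnd x a) x _
    rw [stdEnd_stdMk, stdEnd_stdMk, Linear.smul_comp, map_smul])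

lemma stdEnd_id (x : C) : R.stdEnd x (𝟙 x) = 𝟙 (R.stdLeft x) :=
  R.std_hom_ext (by rw [stdEnd_stdMk, Category.comp_id, comps_id])

/-- Precomposition reverses the order of products; this is the source of the opposite algebra. -/
lemma stdEnd_comp (x : C) (a b : x ⟶ x) : R.stdEnd x (a ≫ b) = R.stdEnd x b ≫ R.stdEnd x a :=
  R.std_hom_ext (by
    rw [comps_comp, stdEnd_stdMk, stdEnd_stdMk, stdEnd_stdMk, Category.assoc])

/-- The action of the local algebra on the left standard module. -/
def stdEndHom (x : C) : (R.localAlg x)ᵐᵒᵖ →ₐ[k] End (R.stdLeft x) :=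
  AlgHom.ofLinearMap
    { toFun := fun a => R.stdEnd x a.unop.1
      map_add' := fun a b => R.stdEnd_add x a.unop.1 b.unop.1
      map_smul' := fun r a => R.stdEnd_smul x r a.unop.1 }
    (R.stdEnd_id x) (fun a b => R.stdEnd_comp x a.unop.1 b.unop.1)

/-- Endomorphisms correspond to elements of `Δ_x(x)`. Each of these has exactly one representative
in `C⁺(x, x) = A_x⁰`, because `C⁺` is a complement of the ideal. -/
lemma stdEndHom_bijective (x : C) : Function.Bijective (R.stdEndHom x) := by
  constructor
  · rw [injective_iff_map_eq_zero]
    intro a ha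
    have h : R.stdMk x x (a.unop.1 ≫ 𝟙 x) = 0 :=
      congrArg (fun φ : R.stdLeft x ⟶ R.stdLeft x => comps φ x (R.stdMk x x (𝟙 x))) ha
    rw [Category.comp_id, stdMk_eq_zero_iff] at h
    exact MulOpposite.unop_injective (Subtype.ext
      (R.eq_zero_of_mem_plus_of_mem_ideal a.unop.2.1 h))
  · intro φ
    obtain ⟨t, ht⟩ := R.stdMk_surjective x x (comps φ x (R.stdMk x x (𝟙 x)))
    obtain ⟨f, hf, hi⟩ := R.exists_plus_sub_mem_ideal t
    refine ⟨MulOpposite.op ⟨f, hf, R.plus_self x ▸ hf⟩, R.std_hom_ext ?_⟩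
    refine Eq.trans ?_ ht
    change comps (R.stdEnd x f) x _ = _
    rw [stdEnd_stdMk, Category.comp_id, eq_comm, ← sub_eq_zero, ← map_sub, stdMk_eq_zero_iff]
    exact hi

/-- The endomorphism algebra of the left standard module. -/
def stdEndEquiv (x : C) : End (R.stdLeft x) ≃ₐ[k] (R.localAlg x)ᵐᵒᵖ :=
  (AlgEquiv.ofBijective _ (R.stdEndHom_bijective x)).symm

/-! ### The local left module -/

open scoped Classical in
/-- The submodules by which the local left module is defined. -/
abbrev locSub (x : C) (y : R.minus.Obj) : Submodule k ((⟨x⟩ : R.minus.Obj) ⟶ y) :=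
  if R.deg y.as < R.deg x then ⊤ else ⊥

lemma locSub_comp (x : C) {y z : R.minus.Obj} (f : (⟨x⟩ : R.minus.Obj) ⟶ y) (g : y ⟶ z)
    (hf : f ∈ R.locSub x y) : f ≫ g ∈ R.locSub x z := by
  unfold locSub at *
  split_ifs with hz
  · trivial
  · split_ifs at hf with hy
    · have hg : g = 0 := by
        by_contra h
        rcases R.minus_deg g.1 g.2 (fun h' => h (Subtype.ext h')) with h' | h'
        · exact hz (h' ▸ hy)
        · exact hz (h'.trans hy)
      rw [hg, comp_zero]
      exact zero_mem _
    · rw [(Submodule.mem_bot k).1 hf, zero_comp]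
      exact zero_mem _

/-- The class of a morphism in the local left module. -/
def locMk (x : C) (y : R.minus.Obj) :
    ((⟨x⟩ : R.minus.Obj) ⟶ y) →ₗ[k] (R.localLeft x).obj.obj y :=
  quotMk (R.locSub_comp x) y

lemma locMk_surjective (x : C) (y : R.minus.Obj) : Function.Surjective (R.locMk x y) :=
  quotMk_surjective (R.locSub_comp x) y

lemma locMk_eq_zero_iff {x : C} {y : R.minus.Obj} {f : (⟨x⟩ : R.minus.Obj) ⟶ y} :
    R.locMk x y f = 0 ↔ f ∈ R.locSub x y :=
  quotMk_eq_zero_iff (R.locSub_comp x)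

lemma locMk_eq_zero {x : C} {y : R.minus.Obj} (f : (⟨x⟩ : R.minus.Obj) ⟶ y)
    (hy : R.deg y.as < R.deg x) : R.locMk x y f = 0 := by
  rw [locMk_eq_zero_iff, locSub, if_pos hy]
  trivial

lemma act_locMk {x : C} {y z : R.minus.Obj} (f : (⟨x⟩ : R.minus.Obj) ⟶ y) (g : y ⟶ z) :
    act (R.localLeft x) g (R.locMk x y f) = R.locMk x z (f ≫ g) := rfl

lemma act_locMk_id {x : C} {y : R.minus.Obj} (g : (⟨x⟩ : R.minus.Obj) ⟶ y) :
    act (R.localLeft x) g (R.locMk x ⟨x⟩ (𝟙 _)) = R.locMk x y g := by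
  rw [act_locMk, Category.id_comp]

/-- The relation `g ⊗ 1 = 1 ⊗ g`: a morphism of `C⁻` moves across the tensor sign. -/
lemma indTensor_locMk {x z : C} {g : x ⟶ z} (hg : g ∈ R.minus.hom x z) :
    LinSub.indTensor (R.localLeft x) z ⟨x⟩ g (R.locMk x ⟨x⟩ (𝟙 _)) =
      LinSub.indTensor (R.localLeft x) z ⟨z⟩ (𝟙 z)
        (R.locMk x ⟨z⟩ (⟨g, hg⟩ : (⟨x⟩ : R.minus.Obj) ⟶ ⟨z⟩)) := by
  have := LinSub.indTensor_balanced (R.localLeft x) z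
    (⟨g, hg⟩ : (⟨x⟩ : R.minus.Obj) ⟶ ⟨z⟩) (𝟙 z) (R.locMk x ⟨x⟩ (𝟙 _))
  rwa [Category.comp_id, act_locMk_id] at this

/-- On a spanning element `f ∘ g` of the ideal, the factor `g` moves across the tensor sign and
becomes zero in the local module, since its target has degree less than `deg x`. -/
lemma act_indTensor_locMk_eq_zero {x y : C} {f : x ⟶ y} (hf : f ∈ R.ideal (R.deg x) x y) :
    actOn (R.minus.inductionLeft (R.localLeft x))
      (LinSub.indTensor (R.localLeft x) x ⟨x⟩ (𝟙 x) (R.locMk x ⟨x⟩ (𝟙 _))) y f = 0 := by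
  suffices h : R.ideal (R.deg x) x y ≤ LinearMap.ker (actOn
    (R.minus.inductionLeft (R.localLeft x))
      (LinSub.indTensor (R.localLeft x) x ⟨x⟩ (𝟙 x) (R.locMk x ⟨x⟩ (𝟙 _))) y) from h hf
  refine Submodule.span_le.2 ?_
  rintro _ ⟨z, g, f, hz, hg, hf, rfl⟩
  rw [SetLike.mem_coe, LinearMap.mem_ker]
  rw [actOn_apply, act_comp, LinSub.act_indTensor, Category.id_comp, R.indTensor_locMk hg,
    R.locMk_eq_zero _ hz, map_zero, map_zero]

/-- The morphism from the left standard module to the induced module. -/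
def stdToInd (x : C) : R.stdLeft x ⟶ R.minus.inductionLeft (R.localLeft x) :=
  R.stdDesc (LinSub.indTensor (R.localLeft x) x ⟨x⟩ (𝟙 x) (R.locMk x ⟨x⟩ (𝟙 _)))
    fun _ _ hf => R.act_indTensor_locMk_eq_zero hf

lemma stdToInd_stdMk {x y : C} (f : x ⟶ y) : comps (R.stdToInd x) y (R.stdMk x y f) =
    LinSub.indTensor (R.localLeft x) y ⟨x⟩ f (R.locMk x ⟨x⟩ (𝟙 _)) := by
  unfold stdToInd
  rw [stdDesc_stdMk, LinSub.act_indTensor, Category.id_comp]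

/-- The morphism from the local left module to the restricted standard module. -/
def locToStd (x : C) : R.localLeft x ⟶ R.minus.restrict (R.stdLeft x) :=
  quotDesc (N := R.minus.restrict (R.stdLeft x)) (R.locSub_comp x) (R.stdMk x x (𝟙 x))
    fun y f hf => by
      change R.stdMk x y.as (𝟙 x ≫ f.1) = 0
      rw [Category.id_comp, stdMk_eq_zero_iff]
      by_cases hy : R.deg y.as < R.deg x
      · exact R.mem_ideal_of_mem_minus f.2 hy
      · rw [locSub, if_neg hy] at hf
        rw [(Submodule.mem_bot k).1 hf]
        exact zero_mem (R.ideal (R.deg x) x y.as)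

lemma locToStd_locMk {x : C} {y : R.minus.Obj} (f : (⟨x⟩ : R.minus.Obj) ⟶ y) :
    LinSub.restrictComps (R.locToStd x) y (R.locMk x y f) = R.stdMk x y.as f.1 :=
  congrArg (R.stdMk x y.as) (Category.id_comp f.1)

/-- The left standard module is induced from the local algebra. -/
def stdIsoInd (x : C) : R.stdLeft x ≅ R.minus.inductionLeft (R.localLeft x) where
  hom := R.stdToInd x
  inv := LinSub.indDesc (R.locToStd x)
  hom_inv_id := R.std_hom_ext (by
    rw [comps_comp, stdToInd_stdMk, LinSub.indDesc_indTensor, act_id, locToStd_locMk]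
    rfl)
  inv_hom_id := LinSub.ind_hom_ext fun z m => by
    obtain ⟨g, rfl⟩ := R.locMk_surjective x z m
    rw [comps_comp, LinSub.indDesc_indTensor, act_id, comps_id, locToStd_locMk, stdToInd_stdMk,
      R.indTensor_locMk g.2]
    rfl

end GenReedy

/-! ## Vanishing of extensions -/

namespace GenReedy

variable {k : Type u} [CommRing k] {C : Type u} [SmallCategory C] [Preadditive C] [Linear k C]
variable (R : GenReedy k C)

/-- Composition with a morphism of `C⁰` on the left, on the morphisms of `C⁰`. -/
def zeroPrecomp {w w' : C} {a : w ⟶ w'} (ha : a ∈ R.zero.hom w w') (z : C) :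
    R.zero.hom w' z →ₗ[k] R.zero.hom w z :=
  (Linear.leftComp k z a).restrict fun _ hf => R.zero.comp_mem ha hf

/-- Composition with a morphism of `C⁰` on the left, on the morphisms of `C⁺`. -/
def plusPrecomp {w w' : C} {a : w ⟶ w'} (ha : a ∈ R.zero.hom w w') (y : C) :
    R.plus.hom w' y →ₗ[k] R.plus.hom w y :=
  (Linear.leftComp k y a).restrict fun _ hf => R.plus.comp_mem ha.1 hf

open scoped Classical in
/-- The sum of the composites of a family of morphisms of `C⁰` with a family of morphisms. -/
def familySum {J : Type u} {z : J → C} {y : C} (e : ∀ j, R.plus.hom (z j) y) (w : C) :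
    (⨁ j, R.zero.hom w (z j)) →ₗ[k] (w ⟶ y) :=
  DirectSum.toModule k J (w ⟶ y)
    (fun j => Linear.rightComp k w (e j).1 ∘ₗ (R.zero.hom w (z j)).subtype)

open scoped Classical in
/-- A morphism of `C⁰` as a family of morphisms. -/
def familyIn {J : Type u} (z : J → C) (w : C) (j : J) :
    R.zero.hom w (z j) →ₗ[k] ⨁ j, R.zero.hom w (z j) :=
  DirectSum.lof k J (fun j => R.zero.hom w (z j)) j

variable {R} in
lemma familySum_familyIn {J : Type u} {z : J → C} {y : C} (e : ∀ j, R.plus.hom (z j) y) (w : C)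
    (j : J) (a : R.zero.hom w (z j)) :
    R.familySum e w (R.familyIn z w j a) = a.1 ≫ (e j).1 := by
  classical
  exact DirectSum.toModule_lof (M := fun j => R.zero.hom w (z j))
    (φ := fun j => Linear.rightComp k w (e j).1 ∘ₗ (R.zero.hom w (z j)).subtype) k j a

variable {R} in
lemma family_linear_ext {J : Type u} {z : J → C} {w : C} {V : Type*} [AddCommGroup V] [Module k V]
    {φ ψ : (⨁ j, R.zero.hom w (z j)) →ₗ[k] V}
    (h : ∀ j a, φ (R.familyIn z w j a) = ψ (R.familyIn z w j a)) : φ = ψ := by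
  classical
  exact DirectSum.linearMap_ext k fun j => LinearMap.ext fun a => h j a

/-- Composition with a morphism of `C⁰` on the left, on families. -/
def familyPrecomp {J : Type u} (z : J → C) {w w' : C} {a : w ⟶ w'} (ha : a ∈ R.zero.hom w w') :
    (⨁ j, R.zero.hom w' (z j)) →ₗ[k] ⨁ j, R.zero.hom w (z j) :=
  DirectSum.lmap fun j => R.zeroPrecomp ha (z j)

variable {R} in
lemma familyPrecomp_familyIn {J : Type u} (z : J → C) {w w' : C} {a : w ⟶ w'}
    (ha : a ∈ R.zero.hom w w') (j : J) (b : R.zero.hom w' (z j)) :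
    R.familyPrecomp z ha (R.familyIn z w' j b) =
      R.familyIn z w j ⟨a ≫ b.1, R.zero.comp_mem ha b.2⟩ := by
  classical
  exact DirectSum.lmap_lof (fun j => R.zeroPrecomp ha (z j)) j b

/-- The right `C⁰`-module `C⁺(-, y)` has a dual basis. -/
def PlusDualBasis (y : C) : Prop :=
  ∃ (J : Type u) (z : J → C) (e : ∀ j, R.plus.hom (z j) y)
    (φ : ∀ w, R.plus.hom w y →ₗ[k] ⨁ j, R.zero.hom w (z j)),
    (∀ (w w' : C) (a : w ⟶ w') (ha : a ∈ R.zero.hom w w') (f : R.plus.hom w' y),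
      φ w (R.plusPrecomp ha y f) = R.familyPrecomp z ha (φ w' f)) ∧
    ∀ (w : C) (f : R.plus.hom w y), R.familySum e w (φ w f) = f.1

/-! ### Transfer of dual bases from `C⁰` to `C⁻` -/

section Transfer

variable {R} {J : Type u} (z : J → C)

/-- The free right `C⁻`-module on a family of objects. -/
abbrev minusFree : RMod k R.minus.Obj := freeMod k (fun j => op (⟨z j⟩ : R.minus.Obj))

/-- A morphism of `C⁻` as an element of a free right module. -/
def minusFreeIn (x : C) (j : J) :
    R.minus.hom x (z j) →ₗ[k] (minusFree (R := R) z).obj.obj (op ⟨x⟩) where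
  toFun g := freeIn (fun j => op (⟨z j⟩ : R.minus.Obj)) (op ⟨x⟩) j
    (Quiver.Hom.op (X := (⟨x⟩ : R.minus.Obj)) (Y := ⟨z j⟩) g)
  map_add' g g' := map_add (freeIn (k := k) (fun j => op (⟨z j⟩ : R.minus.Obj)) (op ⟨x⟩) j)
    (Quiver.Hom.op (X := (⟨x⟩ : R.minus.Obj)) (Y := ⟨z j⟩) g)
    (Quiver.Hom.op (X := (⟨x⟩ : R.minus.Obj)) (Y := ⟨z j⟩) g')
  map_smul' r g := map_smul (freeIn (k := k) (fun j => op (⟨z j⟩ : R.minus.Obj)) (op ⟨x⟩) j) r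
    (Quiver.Hom.op (X := (⟨x⟩ : R.minus.Obj)) (Y := ⟨z j⟩) g)

lemma act_minusFreeIn {x x' : R.minus.Obj} (b : x' ⟶ x) (j : J) (g : R.minus.hom x.as (z j)) :
    act (minusFree (R := R) z) b.op (minusFreeIn z x.as j g) =
      minusFreeIn z x'.as j ⟨b.1 ≫ g.1, R.minus.comp_mem b.2 g.2⟩ :=
  act_freeIn _ _ _

open scoped Classical in
/-- Composition of morphisms of `C⁻` with families of morphisms of `C⁰`. -/
def zeroToMinus (x w : C) : (⨁ j, R.zero.hom w (z j)) →ₗ[k]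
    R.minus.hom x w →ₗ[k] (minusFree (R := R) z).obj.obj (op ⟨x⟩) :=
  DirectSum.toModule k J _ fun j => (LinearMap.mk₂ k
    (fun a g => (⟨g.1 ≫ a.1, R.minus.comp_mem g.2 a.2.2⟩ : R.minus.hom x (z j)))
    (fun _ _ _ => Subtype.ext (Preadditive.comp_add _ _ _ _ _ _))
    (fun _ _ _ => Subtype.ext (Linear.comp_smul _ _ _ _ _ _))
    (fun _ _ _ => Subtype.ext (Preadditive.add_comp _ _ _ _ _ _))
    (fun _ _ _ => Subtype.ext (Linear.smul_comp _ _ _ _ _ _))).compr₂ (minusFreeIn z x j)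

lemma zeroToMinus_familyIn (x w : C) (j : J) (a : R.zero.hom w (z j)) (g : R.minus.hom x w) :
    zeroToMinus z x w (R.familyIn z w j a) g =
      minusFreeIn z x j ⟨g.1 ≫ a.1, R.minus.comp_mem g.2 a.2.2⟩ := by
  unfold zeroToMinus familyIn
  rw [DirectSum.toModule_lof]
  rfl

/-- The compatibility over `C⁰` that allows a map to be defined on `C(x, y)` through its
decomposition. -/
lemma zeroToMinus_precomp (x : C) {w w' : C} {a : w ⟶ w'} (ha : a ∈ R.zero.hom w w')
    (t : ⨁ j, R.zero.hom w' (z j)) (g : R.minus.hom x w) :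
    zeroToMinus z x w (R.familyPrecomp z ha t) g =
      zeroToMinus z x w' t ⟨g.1 ≫ a, R.minus.comp_mem g.2 ha.2⟩ := by
  classical
  refine LinearMap.congr_fun (f := (zeroToMinus z x w).flip g ∘ₗ
      R.familyPrecomp z ha)
    (g := (zeroToMinus z x w').flip ⟨g.1 ≫ a, R.minus.comp_mem g.2 ha.2⟩)
    (family_linear_ext fun j b => ?_) t
  simp only [LinearMap.comp_apply, LinearMap.flip_apply]
  rw [familyPrecomp_familyIn, zeroToMinus_familyIn, zeroToMinus_familyIn]
  exact congrArg _ (Subtype.ext (Category.assoc _ _ _).symm)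

lemma act_zeroToMinus {x x' : R.minus.Obj} (b : x' ⟶ x) (w : C) (t : ⨁ j, R.zero.hom w (z j))
    (g : R.minus.hom x.as w) : act (minusFree (R := R) z) b.op (zeroToMinus z x.as w t g) =
      zeroToMinus z x'.as w t ⟨b.1 ≫ g.1, R.minus.comp_mem b.2 g.2⟩ := by
  classical
  refine LinearMap.congr_fun
    (f := act (minusFree (R := R) z) b.op ∘ₗ (zeroToMinus z x.as w).flip g)
    (g := (zeroToMinus z x'.as w).flip ⟨b.1 ≫ g.1, R.minus.comp_mem b.2 g.2⟩)
    (family_linear_ext fun j a => ?_) t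
  simp only [LinearMap.comp_apply, LinearMap.flip_apply]
  rw [zeroToMinus_familyIn, zeroToMinus_familyIn, act_minusFreeIn]
  exact congrArg _ (Subtype.ext (Category.assoc _ _ _).symm)

/-- The morphism from the free right module to a representable module given by a family. -/
def minusFreeDesc {y : C} (e : ∀ j, R.plus.hom (z j) y) :
    minusFree (R := R) z ⟶ R.minus.restrictedRep y :=
  freeDesc (N := R.minus.restrictedRep y) fun j => (e j).1

lemma minusFreeDesc_minusFreeIn {y : C} (e : ∀ j, R.plus.hom (z j) y) (x : C) (j : J)
    (g : R.minus.hom x (z j)) : comps (minusFreeDesc z e) (op ⟨x⟩) (minusFreeIn z x j g) =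
      (g.1 ≫ (e j).1 : x ⟶ y) :=
  freeDesc_freeIn (z := fun j => op (⟨z j⟩ : R.minus.Obj)) (N := R.minus.restrictedRep y)
    (fun j => (e j).1) (op ⟨x⟩) j _

/-- Reduces the retraction identity over `C⁻` to the dual basis identity over `C⁰`. -/
lemma minusFreeDesc_zeroToMinus {y : C} (e : ∀ j, R.plus.hom (z j) y) (x w : C)
    (t : ⨁ j, R.zero.hom w (z j)) (g : R.minus.hom x w) :
    comps (minusFreeDesc z e) (op ⟨x⟩) (zeroToMinus z x w t g) =
      Linear.leftComp k y g.1 (R.familySum e w t) := by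
  refine LinearMap.congr_fun
    (f := comps (minusFreeDesc z e) (op ⟨x⟩) ∘ₗ (zeroToMinus z x w).flip g)
    (g := Linear.leftComp k y g.1 ∘ₗ R.familySum e w) (family_linear_ext fun j a => ?_) t
  simp only [LinearMap.comp_apply, LinearMap.flip_apply]
  rw [zeroToMinus_familyIn]
  refine (minusFreeDesc_minusFreeIn z e x j _).trans ?_
  exact (Category.assoc _ _ _).trans
    (congrArg (fun t : w ⟶ y => g.1 ≫ t) (familySum_familyIn e w j a)).symm

end Transfer

variable {R} in
/-- If `C⁺(-, y)` has a dual basis over `C⁰` then `C(-, y)` is a projective right `C⁻`-module. -/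
lemma PlusDualBasis.projective_restrictedRep {y : C} (h : R.PlusDualBasis y) :
    Projective (R.minus.restrictedRep y) := by
  obtain ⟨J, z, e, φ, hφ, he⟩ := h
  -- This is `φ` tensored with `C⁻`: under `C(x, y) = C⁺(-, y) ⊗ C⁻(x, -)`, `L` sends `f ∘ g` to the
  -- family `φ(f)` precomposed with `g`.
  choose L hL using fun x : C => R.exists_lift (x := x) (y := y)
    (V := (minusFree (R := R) z).obj.obj (op ⟨x⟩))
    (fun w => zeroToMinus z x w ∘ₗ φ w) (fun w a ha f g =>
      (congrArg (fun t => zeroToMinus z x w t g) (hφ w w a ha f)).trans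
        (zeroToMinus_precomp z x ha (φ w f) g))
  have hnat : ∀ {x x' : R.minus.Obj} (b : x' ⟶ x) (t : x.as ⟶ y),
      L x'.as (b.1 ≫ t) = act (minusFree (R := R) z) b.op (L x.as t) := by
    intro x x' b t
    refine LinearMap.congr_fun (f := L x'.as ∘ₗ Linear.leftComp k y b.1)
      (g := act (minusFree (R := R) z) b.op ∘ₗ L x.as)
      (R.hom_linear_ext fun w g f hg hf => ?_) t
    rw [LinearMap.comp_apply, LinearMap.comp_apply, hL x.as w ⟨f, hf⟩ ⟨g, hg⟩,
      Linear.leftComp_apply, ← Category.assoc,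
      hL x'.as w ⟨f, hf⟩ ⟨b.1 ≫ g, R.minus.comp_mem b.2 hg⟩]
    exact (act_zeroToMinus z b w (φ w ⟨f, hf⟩) ⟨g, hg⟩).symm
  let σ : R.minus.restrictedRep y ⟶ minusFree (R := R) z :=
    homOfComps (M := R.minus.restrictedRep y) (fun x => L x.unop.as) fun b t => hnat b.unop t
  -- On a composite `f ∘ g` the two maps give the sum of the `e_j ∘ φ_j(f) ∘ g`, which is `f ∘ g` by
  -- the dual basis identity. Thus `C(-, y)` is a retract of a free module.
  refine (Retract.mk σ (minusFreeDesc z e) (hom_ext_comps fun x t => ?_)).projective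
  refine LinearMap.congr_fun (f := comps (minusFreeDesc z e) x ∘ₗ L x.unop.as)
    (g := LinearMap.id) (R.hom_linear_ext fun w g f hg hf => ?_) t
  refine (congrArg (comps (minusFreeDesc z e) x) (hL x.unop.as w ⟨f, hf⟩ ⟨g, hg⟩)).trans ?_
  refine (minusFreeDesc_zeroToMinus z e x.unop.as w (φ w ⟨f, hf⟩) ⟨g, hg⟩).trans ?_
  exact congrArg (fun t => g ≫ t) (he w ⟨f, hf⟩)

/-! ### Supports of `C⁻`-modules and dimension shifting -/

lemma subsingleton_stdLeft_of_lt {x y : C} (h : R.deg y < R.deg x) :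
    Subsingleton ((R.stdLeft x).obj.obj y) :=
  R.subsingleton_stdLeft fun h' => h'.elim (fun e => lt_irrefl _ (e ▸ h)) fun h' => lt_asymm h h'

/-- A left `C⁻`-module is supported in degrees less than `β`. -/
def SupportedBelow (β : Ordinal.{u}) (N : LMod k R.minus.Obj) : Prop :=
  ∀ z : R.minus.Obj, ¬ R.deg z.as < β → Subsingleton (N.obj.obj z)

variable {R}

lemma SupportedBelow.deg_lt {β : Ordinal.{u}} {N : LMod k R.minus.Obj} (hN : R.SupportedBelow β N)
    {z : R.minus.Obj} {n : N.obj.obj z} (hn : n ≠ 0) : R.deg z.as < β := by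
  by_contra h
  exact hn ((hN z h).elim _ _)

lemma SupportedBelow.of_injective {β : Ordinal.{u}} {N M : LMod k R.minus.Obj} (i : N ⟶ M)
    (h : ∀ z : R.minus.Obj, ¬ R.deg z.as < β → Function.Injective (comps i z) ∧
      ∀ n, comps i z n = 0) : R.SupportedBelow β N := fun z hz =>
  subsingleton_of_forall_eq 0 fun n => (h z hz).1 (((h z hz).2 n).trans (map_zero _).symm)

lemma eq_zero_of_minus {x z : R.minus.Obj} (f : x ⟶ z) (hne : x.as ≠ z.as)
    (h : ¬ R.deg z.as < R.deg x.as) : f = 0 := by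
  by_contra h0
  rcases R.minus_deg f.1 f.2 (fun h' => h0 (Subtype.ext h')) with h' | h'
  · exact hne h'
  · exact h h'

/-- The generators of the cover sit at objects carrying nonzero elements, hence of degree less than
`β`, and morphisms of `C⁻` do not lead from there to objects of larger or equal degree. So the cover
itself already lives below `β`. -/
lemma SupportedBelow.kernel_coverMap {β : Ordinal.{u}} {N : LMod k R.minus.Obj}
    (hN : R.SupportedBelow β N) : R.SupportedBelow β (kernel (coverMap N)) := by
  refine .of_injective (kernel.ι (coverMap N)) fun z hz =>
    ⟨comps_injective_of_mono _ z, fun n => free_ext_coord fun s => ?_⟩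
  rw [map_zero]
  have hs := hN.deg_lt s.2.2
  exact eq_zero_of_minus _ (fun h => hz (h ▸ hs)) fun h => hz (h.trans hs)

variable (R) in
/-- The canonical generator of the local left module, as a morphism from a free module. -/
def locCover (x : C) :
    freeMod k (fun _ : PUnit.{u + 1} => (⟨x⟩ : R.minus.Obj)) ⟶ R.localLeft x :=
  freeDesc fun _ => R.locMk x ⟨x⟩ (𝟙 _)

lemma locCover_freeIn (x : C) (z : R.minus.Obj) (f : (⟨x⟩ : R.minus.Obj) ⟶ z) :
    comps (R.locCover x) z (freeIn (fun _ => ⟨x⟩) z PUnit.unit f) = R.locMk x z f := by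
  unfold locCover
  rw [freeDesc_freeIn, act_locMk_id]

lemma locCover_surjective (x : C) (z : R.minus.Obj) :
    Function.Surjective (comps (R.locCover x) z) := fun m => by
  obtain ⟨f, rfl⟩ := R.locMk_surjective x z m
  exact ⟨_, locCover_freeIn x z f⟩

instance (x : C) : Epi (R.locCover x) := epi_of_comps_surjective _ (locCover_surjective x)

instance (N : LMod k R.minus.Obj) : Epi (coverMap N) :=
  epi_of_comps_surjective _ (coverMap_surjective N)

/-- At objects of degree not below `deg x` nothing is divided out of `C⁻(x, -)`, so the cover is
injective there. -/
lemma supportedBelow_kernel_locCover (x : C) :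
    R.SupportedBelow (R.deg x) (kernel (R.locCover x)) := by
  refine .of_injective (kernel.ι (R.locCover x)) fun z hz =>
    ⟨comps_injective_of_mono _ z, fun n => ?_⟩
  set t := comps (kernel.ι (R.locCover x)) z n with ht
  have h1 : comps (R.locCover x) z t = 0 := by
    rw [ht, ← comps_comp, kernel.condition]
    rfl
  -- The free module has a single generator, so an element is its only coordinate.
  have h2 : freeIn (k := k) (fun _ : PUnit.{u + 1} => (⟨x⟩ : R.minus.Obj)) z PUnit.unit
      (freeCoord _ z PUnit.unit t) = t :=
    free_ext_coord fun s => by rw [freeCoord_freeIn_self]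
  rw [← h2, locCover_freeIn, locMk_eq_zero_iff, locSub, if_neg hz, Submodule.mem_bot] at h1
  rw [← h2, h1, map_zero]

variable [∀ y, Projective (R.minus.restrictedRep y)]

/-- Induction on `n` for all `N` at once, since each shift replaces `N` by the kernel of its cover.
For `n = 0`, the module `N` lives below `β` and the standard module of `y` is zero there. -/
lemma subsingleton_ext_of_supportedBelow {β : Ordinal.{u}} {y : C} (hy : β ≤ R.deg y) (n : ℕ) :
    ∀ N : LMod k R.minus.Obj, R.SupportedBelow β N →
      Subsingleton (Abelian.Ext (R.minus.inductionLeft N) (R.stdLeft y) n) := by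
  induction n with
  | zero =>
    intro N hN
    have := LinSub.subsingleton_hom_induction N (R.stdLeft y) fun z => by
      by_cases hz : R.deg z.as < β
      · exact Or.inr (R.subsingleton_stdLeft_of_lt (hz.trans_le hy))
      · exact Or.inl (hN z hz)
    exact Abelian.Ext.homEquiv₀.subsingleton
  | succ n ih =>
    exact fun N hN => LinSub.ext_induction_succ (coverMap N) _ n (ih _ hN.kernel_coverMap)

/-- One shift along `C⁻(x, -) ⟶ A_x⁰` replaces the local module, which is nonzero at `x` in general,
by a kernel living strictly below `deg x`. This is why the equality `deg x = deg y` is allowed for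
positive Ext degrees. -/
lemma subsingleton_ext_std {x y : C} (h : R.deg x ≤ R.deg y) (n : ℕ) :
    Subsingleton (Abelian.Ext (R.stdLeft x) (R.stdLeft y) (n + 1)) := by
  have := LinSub.ext_induction_succ (R.locCover x) (R.stdLeft y) n
    (subsingleton_ext_of_supportedBelow h n _ (supportedBelow_kernel_locCover x))
  refine subsingleton_of_forall_eq 0 fun a => ?_
  -- The class is transported along the isomorphism with the induced module: it factors through a
  -- class in the vanishing Ext group.
  rw [← Abelian.Ext.mk₀_id_comp a, ← (R.stdIsoInd x).hom_inv_id, ← Abelian.Ext.mk₀_comp_mk₀_assoc,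
    Subsingleton.elim ((Abelian.Ext.mk₀ (R.stdIsoInd x).inv).comp a (zero_add _)) 0,
    Abelian.Ext.comp_zero]

lemma deg_lt_of_nontrivial_ext {x y : C} {n : ℕ} (hn : 1 ≤ n)
    (h : Nontrivial (Abelian.Ext (R.stdLeft x) (R.stdLeft y) n)) : R.deg y < R.deg x := by
  by_contra hxy
  obtain ⟨n, rfl⟩ := Nat.exists_eq_add_of_le' hn
  exact not_subsingleton_iff_nontrivial.2 h (subsingleton_ext_std (not_lt.1 hxy) n)

end GenReedy

/-! ## Dual bases from projectivity -/

namespace GenReedy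

variable {k : Type u} [CommRing k] {C : Type u} [SmallCategory C] [Preadditive C] [Linear k C]
variable (R : GenReedy k C)

section

variable {R} {J : Type u} (s : J → R.zero.Objᵒᵖ)

/-- The morphisms of `C⁰` that correspond to a morphism of the opposite category. -/
def zeroUnop (a : R.zero.Objᵒᵖ) (w : C) : (a ⟶ op ⟨w⟩) →ₗ[k] R.zero.hom w a.unop.as where
  toFun f := f.unop
  map_add' _ _ := rfl
  map_smul' _ _ := rfl

/-- The elements of a free right `C⁰`-module as families of morphisms. -/
def zeroFamily (w : C) :
    (freeMod k s).obj.obj (op ⟨w⟩) →ₗ[k] ⨁ j, R.zero.hom w (s j).unop.as :=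
  freeLift s (op ⟨w⟩) fun j =>
    R.familyIn (fun j => (s j).unop.as) w j ∘ₗ zeroUnop (s j) w

lemma zeroFamily_freeIn (w : C) (j : J) (f : s j ⟶ op ⟨w⟩) :
    zeroFamily s w (freeIn s _ j f) =
      R.familyIn (fun j => (s j).unop.as) w j (zeroUnop (s j) w f) :=
  freeLift_freeIn _ _ _ _

lemma zeroFamily_act {w w' : C} {a : w ⟶ w'} (ha : a ∈ R.zero.hom w w')
    (t : (freeMod k s).obj.obj (op ⟨w'⟩)) :
    zeroFamily s w (act (freeMod k s)
      (Quiver.Hom.op (X := (⟨w⟩ : R.zero.Obj)) (Y := ⟨w'⟩) ⟨a, ha⟩) t) =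
    R.familyPrecomp (fun j => (s j).unop.as) ha (zeroFamily s w' t) := by
  refine LinearMap.congr_fun (f := zeroFamily s w ∘ₗ act (freeMod k s)
      (Quiver.Hom.op (X := (⟨w⟩ : R.zero.Obj)) (Y := ⟨w'⟩) ⟨a, ha⟩))
    (g := R.familyPrecomp (fun j => (s j).unop.as) ha ∘ₗ zeroFamily s w')
    (free_linear_ext fun j f => ?_) t
  rw [LinearMap.comp_apply, LinearMap.comp_apply, act_freeIn, zeroFamily_freeIn,
    zeroFamily_freeIn, familyPrecomp_familyIn]
  rfl

end

open scoped Classical in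
/-- The elements of a summand of `C⁺`, as a right `C⁰`-module. -/
def plusIn (w y : C) : R.plus.hom w y →ₗ[k] R.plusRight.obj.obj (op ⟨w⟩) :=
  DirectSum.lof k C (fun y => R.plus.hom w y) y

/-- The coordinates of `C⁺`, as a right `C⁰`-module. -/
def plusCoord (w : R.zero.Objᵒᵖ) (y : C) : R.plusRight.obj.obj w →ₗ[k] R.plus.hom w.unop.as y :=
  DirectSum.component k C (fun y => R.plus.hom w.unop.as y) y

lemma plusCoord_plusIn {w y : C} (f : R.plus.hom w y) :
    R.plusCoord (op ⟨w⟩) y (R.plusIn w y f) = f := by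
  classical
  exact DirectSum.component.lof_self (M := fun y => R.plus.hom w y) k y f

lemma plusIn_precomp {w w' : C} {a : w ⟶ w'} (ha : a ∈ R.zero.hom w w') (y : C)
    (f : R.plus.hom w' y) : R.plusIn w y (R.plusPrecomp ha y f) =
      act R.plusRight (Quiver.Hom.op (X := (⟨w⟩ : R.zero.Obj)) (Y := ⟨w'⟩) ⟨a, ha⟩)
        (R.plusIn w' y f) := by
  classical
  exact (DirectSum.lmap_lof (fun y => R.plusPrecomp ha y) y f).symm

/-- `C⁺(-, y)` is a direct summand of `C⁺`. The map `φ` is its inclusion followed by a section of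
the free cover, and `e_j` is the component in `C⁺(-, y)` of the generator `j`. -/
lemma plusDualBasis [Projective R.plusRight] (y : C) : R.PlusDualBasis y := by
  classical
  obtain ⟨σ, hσ⟩ := exists_section_of_projective R.plusRight
  let s : NonzeroElt R.plusRight → R.zero.Objᵒᵖ := fun j => j.1
  refine ⟨NonzeroElt R.plusRight, fun j => (s j).unop.as, fun j => R.plusCoord j.1 y j.2.1,
    fun w => zeroFamily s w ∘ₗ comps σ (op ⟨w⟩) ∘ₗ R.plusIn w y, fun w w' a ha f => ?_,
    fun w f => ?_⟩
  · simp only [LinearMap.comp_apply]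
    rw [plusIn_precomp, comps_act, zeroFamily_act]
  -- Summing a family against the `e_j` is the covering map followed by projection to the summand
  -- `y`; this is checked on generators.
  · have key : ∀ t, R.familySum (z := fun j => (s j).unop.as)
        (fun j : NonzeroElt R.plusRight => R.plusCoord j.1 y j.2.1) w (zeroFamily s w t) =
        (R.plusCoord (op ⟨w⟩) y (comps (coverMap R.plusRight) (op ⟨w⟩) t)).1 := by
      intro t
      refine LinearMap.congr_fun (f := R.familySum (z := fun j => (s j).unop.as)
        (fun j : NonzeroElt R.plusRight => R.plusCoord j.1 y j.2.1) w ∘ₗ zeroFamily s w)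
        (g := (R.plus.hom w y).subtype ∘ₗ R.plusCoord (op ⟨w⟩) y ∘ₗ
          comps (coverMap R.plusRight) (op ⟨w⟩)) (free_linear_ext fun j a => ?_) t
      simp only [LinearMap.comp_apply]
      rw [zeroFamily_freeIn, familySum_familyIn]
      exact (congrArg (fun n => (R.plusCoord (op ⟨w⟩) y n).1)
        (freeDesc_freeIn (z := s) (N := R.plusRight) (fun j => j.2.1) (op ⟨w⟩) j a)).symm
    refine (key _).trans ?_
    rw [LinearMap.comp_apply, ← comps_comp, hσ, comps_id, plusCoord_plusIn]

end GenReedy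

/-! ## The opposite of a Reedy category -/

section Opposite

variable {k : Type u} [CommRing k] {C : Type u} [SmallCategory C] [Preadditive C] [Linear k C]

variable (k) in
/-- Passage to the opposite category on morphisms. -/
def opHom (x y : C) : (x ⟶ y) ≃ₗ[k] (op y ⟶ op x) where
  toFun f := f.op
  invFun f := f.unop
  map_add' _ _ := rfl
  map_smul' _ _ := rfl
  left_inv _ := rfl
  right_inv _ := rfl

/-- The opposite of a subcategory. -/
def LinSub.opposite (S : LinSub k C) : LinSub k Cᵒᵖ where
  hom x y := (S.hom y.unop x.unop).comap (opHom k y.unop x.unop).symm.toLinearMap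
  id_mem x := S.id_mem x.unop
  comp_mem hf hg := S.comp_mem hg hf

namespace GenReedy

open scoped Classical in
/-- The class of a pure tensor in the domain of `rho`. -/
def rhoIn (P M : LinSub k C) (x y z : C) : P.hom z y →ₗ[k] M.hom x z →ₗ[k]
    ⨁ z : C, (P.hom z y ⊗[k] M.hom x z) ⧸ balanced P M x y z :=
  (TensorProduct.mk k (P.hom z y) (M.hom x z)).compr₂
    (DirectSum.lof k C (fun z => (P.hom z y ⊗[k] M.hom x z) ⧸ balanced P M x y z) z ∘ₗ
      (balanced P M x y z).mkQ)

lemma rho_rhoIn (P M : LinSub k C) (x y z : C) (f : P.hom z y) (g : M.hom x z) :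
    rho P M x y (rhoIn P M x y z f g) = g.1 ≫ f.1 := by
  unfold rho rhoIn
  erw [DirectSum.toModule_lof]
  rfl

lemma rhoIn_balanced (P M : LinSub k C) (x y z : C) {a : z ⟶ z} (ha : a ∈ (P.inter M).hom z z)
    (f : P.hom z y) (g : M.hom x z) :
    rhoIn P M x y z ⟨a ≫ f.1, P.comp_mem ha.1 f.2⟩ g =
      rhoIn P M x y z f ⟨g.1 ≫ a, M.comp_mem g.2 ha.2⟩ := by
  classical
  exact congrArg (DirectSum.lof k C (fun z => (P.hom z y ⊗[k] M.hom x z) ⧸ balanced P M x y z) z)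
    ((Submodule.Quotient.eq _).2 (Submodule.subset_span ⟨a, ha, f, g, rfl⟩))

lemma rho_domain_ext {P M : LinSub k C} {x y : C} {V : Type*} [AddCommGroup V] [Module k V]
    {φ ψ : (⨁ z : C, (P.hom z y ⊗[k] M.hom x z) ⧸ balanced P M x y z) →ₗ[k] V}
    (h : ∀ z f g, φ (rhoIn P M x y z f g) = ψ (rhoIn P M x y z f g)) : φ = ψ := by
  classical
  refine DirectSum.linearMap_ext _ fun z => Submodule.linearMap_qext _ ?_
  exact TensorProduct.ext' fun f g => h z f g

variable (R : GenReedy k C)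

/-- The decomposition is symmetric: interchanging the two tensor factors identifies the summands for
the opposite category with those for `C`. Injectivity comes from a left inverse built by
`exists_lift`, surjectivity from the spanning composites. -/
lemma rho_op_bijective (x y : Cᵒᵖ) :
    Function.Bijective (rho R.minus.opposite R.plus.opposite x y) := by
  constructor
  -- `exists_lift` needs a target that is an additive group; subtraction obtained from the scalars
  -- leaves the given addition of the direct sum unchanged.
  · let : AddCommGroup (⨁ z : Cᵒᵖ, (R.minus.opposite.hom z y ⊗[k] R.plus.opposite.hom x z) ⧸
        balanced R.minus.opposite R.plus.opposite x y z) := Module.addCommMonoidToAddCommGroup k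
    obtain ⟨L, hL⟩ := R.exists_lift (x := y.unop) (y := x.unop)
      (V := ⨁ z : Cᵒᵖ, (R.minus.opposite.hom z y ⊗[k] R.plus.opposite.hom x z) ⧸
        balanced R.minus.opposite R.plus.opposite x y z)
      (fun z => ((rhoIn R.minus.opposite R.plus.opposite x y (op z)).compl₁₂
        (show R.minus.hom y.unop z →ₗ[k] R.minus.opposite.hom (op z) y from
          { toFun := fun g => ⟨g.1.op, g.2⟩, map_add' := fun _ _ => rfl
            map_smul' := fun _ _ => rfl })
        (show R.plus.hom z x.unop →ₗ[k] R.plus.opposite.hom x (op z) from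
          { toFun := fun f => ⟨f.1.op, f.2⟩, map_add' := fun _ _ => rfl
            map_smul' := fun _ _ => rfl })).flip)
      (fun z a ha f g => (rhoIn_balanced R.minus.opposite R.plus.opposite x y (op z) (a := a.op)
        ⟨ha.2, ha.1⟩ ⟨g.1.op, g.2⟩ ⟨f.1.op, f.2⟩).symm)
    have h : (L ∘ₗ (opHom k y.unop x.unop).symm.toLinearMap) ∘ₗ
        rho R.minus.opposite R.plus.opposite x y = LinearMap.id := by
      refine rho_domain_ext fun z f g => ?_
      rw [LinearMap.comp_apply, rho_rhoIn]
      exact hL z.unop ⟨g.1.unop, g.2⟩ ⟨f.1.unop, f.2⟩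
    exact Function.LeftInverse.injective
      (g := L ∘ₗ (opHom k y.unop x.unop).symm.toLinearMap) (LinearMap.congr_fun h)
  · intro t
    suffices h : Submodule.span k _ ≤ (LinearMap.range
      (rho R.minus.opposite R.plus.opposite x y)).comap
      (opHom k y.unop x.unop).toLinearMap from h (R.mem_span y.unop x.unop t.unop)
    refine Submodule.span_le.2 ?_
    rintro _ ⟨z, g, f, hg, hf, rfl⟩
    exact ⟨_, rho_rhoIn R.minus.opposite R.plus.opposite x y (op z) ⟨g.op, hg⟩ ⟨f.op, hf⟩⟩

/-- The opposite of a Reedy category. -/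
def opposite : GenReedy k Cᵒᵖ where
  skeletal := fun _ _ ⟨e⟩ => unop_injective (R.skeletal ⟨e.symm.unop⟩)
  deg x := R.deg x.unop
  plus := R.minus.opposite
  minus := R.plus.opposite
  plus_deg f hf h0 := (R.minus_deg f.unop hf fun h => h0 (Quiver.Hom.unop_inj h)).imp
    (fun h => (unop_injective h).symm) id
  minus_deg f hf h0 := (R.plus_deg f.unop hf fun h => h0 (Quiver.Hom.unop_inj h)).imp
    (fun h => (unop_injective h).symm) id
  plus_self x := congrArg (Submodule.comap (opHom k x.unop x.unop).symm.toLinearMap)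
    (R.plus_self x.unop).symm
  rho_bijective := R.rho_op_bijective

/-- Reversing a factorization through `z` exchanges the roles of `C⁺` and `C⁻` and keeps the degree
of `z`. -/
lemma mem_op_ideal {α : Ordinal.{u}} {x y : C} {f : x ⟶ y} :
    f.op ∈ R.opposite.ideal α (op y) (op x) ↔ f ∈ R.ideal α x y := by
  constructor
  · intro h
    suffices h' : R.opposite.ideal α (op y) (op x) ≤
      (R.ideal α x y).comap (opHom k x y).symm.toLinearMap from h' h
    refine Submodule.span_le.2 ?_
    rintro _ ⟨z, g, f, hz, hg, hf, rfl⟩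
    exact Submodule.subset_span ⟨z.unop, f.unop, g.unop, hz, hf, hg, rfl⟩
  · intro h
    suffices h' : R.ideal α x y ≤ (R.opposite.ideal α (op y) (op x)).comap
      (opHom k x y).toLinearMap from h' h
    refine Submodule.span_le.2 ?_
    rintro _ ⟨z, g, f, hz, hg, hf, rfl⟩
    exact Submodule.subset_span ⟨op z, f.op, g.op, hz, hf, hg, rfl⟩

/-- The submodules by which the right standard module is defined. -/
abbrev stdSubRight (x : C) (y : Cᵒᵖ) : Submodule k (op x ⟶ y) :=
  (R.ideal (R.deg x) y.unop x).comap (opHom k y.unop x).symm.toLinearMap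

lemma stdSubRight_comp (x : C) {y z : Cᵒᵖ} (f : op x ⟶ y) (g : y ⟶ z)
    (hf : f ∈ R.stdSubRight x y) : f ≫ g ∈ R.stdSubRight x z :=
  R.comp_ideal _ g.unop f.unop hf

/-- The right standard modules are the left standard modules of the opposite category. -/
lemma stdRight_eq (x : C) : R.stdRight x = R.opposite.stdLeft (op x) :=
  quotRep_congr (J := R.stdSubRight x) (hJ := R.stdSubRight_comp x)
    (hJ' := fun f g hf => R.opposite.ideal_comp (R.opposite.deg (op x)) f g hf)
    fun _ => Submodule.ext fun _ => R.mem_op_ideal.symm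

/-- The local algebra of the opposite category. -/
def localAlgOp (x : C) : (R.opposite.localAlg (op x))ᵐᵒᵖ →ₐ[k] R.localAlg x :=
  AlgHom.ofLinearMap
    { toFun := fun a => ⟨a.unop.1.unop, a.unop.2.2, a.unop.2.1⟩
      map_add' := fun _ _ => rfl
      map_smul' := fun _ _ => rfl } rfl fun _ _ => rfl

lemma localAlgOp_bijective (x : C) : Function.Bijective (R.localAlgOp x) :=
  Function.bijective_iff_has_inverse.2
    ⟨fun a => MulOpposite.op ⟨a.1.op, a.2.2, a.2.1⟩, fun _ => rfl, fun _ => rfl⟩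

/-! ### The dual basis of `C⁻` -/

section

variable {R} {J : Type u} (s : J → R.zero.Obj)

/-- The morphisms of `C⁰` as morphisms of the opposite category. -/
def zeroOp (a : R.zero.Obj) (w : Cᵒᵖ) :
    (a ⟶ ⟨w.unop⟩) →ₗ[k] R.opposite.zero.hom w (op a.as) where
  toFun f := ⟨f.1.op, f.2.2, f.2.1⟩
  map_add' _ _ := rfl
  map_smul' _ _ := rfl

/-- The elements of a free left `C⁰`-module as families of morphisms. -/
def zeroFamilyOp (w : Cᵒᵖ) :
    (freeMod k s).obj.obj ⟨w.unop⟩ →ₗ[k] ⨁ j, R.opposite.zero.hom w (op (s j).as) :=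
  freeLift s ⟨w.unop⟩ fun j =>
    R.opposite.familyIn (fun j => op (s j).as) w j ∘ₗ zeroOp (s j) w

lemma zeroFamilyOp_freeIn (w : Cᵒᵖ) (j : J) (f : s j ⟶ ⟨w.unop⟩) :
    zeroFamilyOp s w (freeIn s _ j f) =
      R.opposite.familyIn (fun j => op (s j).as) w j (zeroOp (s j) w f) :=
  freeLift_freeIn _ _ _ _

lemma zeroFamilyOp_act {w w' : Cᵒᵖ} {a : w ⟶ w'} (ha : a ∈ R.opposite.zero.hom w w')
    (t : (freeMod k s).obj.obj ⟨w'.unop⟩) :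
    zeroFamilyOp s w (act (freeMod k s)
      (⟨a.unop, ha.2, ha.1⟩ : (⟨w'.unop⟩ : R.zero.Obj) ⟶ ⟨w.unop⟩) t) =
    R.opposite.familyPrecomp (fun j => op (s j).as) ha (zeroFamilyOp s w' t) := by
  refine LinearMap.congr_fun (f := zeroFamilyOp s w ∘ₗ act (freeMod k s)
      (⟨a.unop, ha.2, ha.1⟩ : (⟨w'.unop⟩ : R.zero.Obj) ⟶ ⟨w.unop⟩))
    (g := R.opposite.familyPrecomp (fun j => op (s j).as) ha ∘ₗ
      zeroFamilyOp s w')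
    (free_linear_ext fun j f => ?_) t
  rw [LinearMap.comp_apply, LinearMap.comp_apply, act_freeIn, zeroFamilyOp_freeIn,
    zeroFamilyOp_freeIn, familyPrecomp_familyIn]
  rfl

end

open scoped Classical in
/-- The elements of a summand of `C⁻`, as a left `C⁰`-module. -/
def minusIn (w y : Cᵒᵖ) : R.opposite.plus.hom w y →ₗ[k] R.minusLeft.obj.obj ⟨w.unop⟩ :=
  DirectSum.lof k C (fun x => R.minus.hom x w.unop) y.unop ∘ₗ
    (show R.opposite.plus.hom w y →ₗ[k] R.minus.hom y.unop w.unop from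
      { toFun := fun f => ⟨f.1.unop, f.2⟩
        map_add' := fun _ _ => rfl
        map_smul' := fun _ _ => rfl })

/-- The coordinates of `C⁻`, as a left `C⁰`-module. -/
def minusCoord (w : R.zero.Obj) (y : Cᵒᵖ) :
    R.minusLeft.obj.obj w →ₗ[k] R.opposite.plus.hom (op w.as) y :=
  (show R.minus.hom y.unop w.as →ₗ[k] R.opposite.plus.hom (op w.as) y from
      { toFun := fun f => ⟨f.1.op, f.2⟩
        map_add' := fun _ _ => rfl
        map_smul' := fun _ _ => rfl }) ∘ₗ
    DirectSum.component k C (fun x => R.minus.hom x w.as) y.unop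

lemma minusCoord_minusIn {w y : Cᵒᵖ} (f : R.opposite.plus.hom w y) :
    R.minusCoord ⟨w.unop⟩ y (R.minusIn w y f) = f := by
  classical
  have := DirectSum.component.lof_self (M := fun x => R.minus.hom x w.unop) k y.unop
    ⟨f.1.unop, f.2⟩
  exact congrArg
    (fun g : R.minus.hom y.unop w.unop => (⟨g.1.op, g.2⟩ : R.opposite.plus.hom w y)) this

lemma minusIn_precomp {w w' : Cᵒᵖ} {a : w ⟶ w'} (ha : a ∈ R.opposite.zero.hom w w') (y : Cᵒᵖ)
    (f : R.opposite.plus.hom w' y) : R.minusIn w y (R.opposite.plusPrecomp ha y f) =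
      act R.minusLeft (⟨a.unop, ha.2, ha.1⟩ : (⟨w'.unop⟩ : R.zero.Obj) ⟶ ⟨w.unop⟩)
        (R.minusIn w' y f) := by
  classical
  exact (DirectSum.lmap_lof (M := fun x => R.minus.hom x w'.unop)
    (fun x => (Linear.rightComp k x a.unop).restrict fun _ hf => R.minus.comp_mem hf ha.1)
    y.unop ⟨f.1.unop, f.2⟩).symm

/-- The argument of `plusDualBasis` with `C⁻` in place of `C⁺`. The categories `R.opposite.zero.Obj`
and `R.zero.Objᵒᵖ` have the same morphisms but are not literally equal, so what is passed to the
opposite side is the dual basis, which is stated through morphisms only, instead of projectivity. -/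
lemma op_plusDualBasis [Projective R.minusLeft] (y : Cᵒᵖ) : R.opposite.PlusDualBasis y := by
  classical
  obtain ⟨σ, hσ⟩ := exists_section_of_projective R.minusLeft
  let s : NonzeroElt R.minusLeft → R.zero.Obj := fun j => j.1
  refine ⟨NonzeroElt R.minusLeft, fun j => op (s j).as,
    fun j => R.minusCoord j.1 y j.2.1,
    fun w => zeroFamilyOp s w ∘ₗ comps σ ⟨w.unop⟩ ∘ₗ R.minusIn w y, fun w w' a ha f => ?_,
    fun w f => ?_⟩
  · simp only [LinearMap.comp_apply]
    rw [minusIn_precomp, comps_act, zeroFamilyOp_act]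
  · have key : ∀ t, R.opposite.familySum (z := fun j => op (s j).as)
        (fun j : NonzeroElt R.minusLeft => R.minusCoord j.1 y j.2.1) w (zeroFamilyOp s w t) =
        (R.minusCoord ⟨w.unop⟩ y (comps (coverMap R.minusLeft) ⟨w.unop⟩ t)).1 := by
      intro t
      refine LinearMap.congr_fun (f := R.opposite.familySum (z := fun j => op (s j).as)
        (fun j : NonzeroElt R.minusLeft => R.minusCoord j.1 y j.2.1) w ∘ₗ zeroFamilyOp s w)
        (g := (R.opposite.plus.hom w y).subtype ∘ₗ R.minusCoord ⟨w.unop⟩ y ∘ₗ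
          comps (coverMap R.minusLeft) ⟨w.unop⟩) (free_linear_ext fun j a => ?_) t
      simp only [LinearMap.comp_apply]
      rw [zeroFamilyOp_freeIn, familySum_familyIn]
      exact (congrArg (fun n => (R.minusCoord ⟨w.unop⟩ y n).1)
        (freeDesc_freeIn (z := s) (N := R.minusLeft) (fun j => j.2.1) ⟨w.unop⟩ j a)).symm
    refine (key _).trans ?_
    rw [LinearMap.comp_apply, ← comps_comp, hσ, comps_id, minusCoord_minusIn]

end GenReedy

end Opposite

/-! ## Right standard modules are induced -/

section InductionRight

variable {k : Type u} [CommRing k] {C : Type u} [SmallCategory C] [Preadditive C] [Linear k C]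

namespace LinSub

variable {S : LinSub k C}

/-- The pure tensors in an induced right module. -/
def indTensorRight (N : RMod k S.Obj) (y : Cᵒᵖ) (z : S.Obj) :
    N.obj.obj (op z) →ₗ[k] (y.unop ⟶ z.as) →ₗ[k] (S.inductionRight N).obj.obj y :=
  pureTensor N.obj (S.incl ⋙ (linearCoyoneda k C).obj y) z

lemma indTensorRight_balanced (N : RMod k S.Obj) (y : Cᵒᵖ) {z w : S.Obj} (a : z ⟶ w)
    (n : N.obj.obj (op w)) (h : y.unop ⟶ z.as) :
    indTensorRight N y z (act N a.op n) h = indTensorRight N y w n (h ≫ a.1) :=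
  pureTensor_balanced (M := S.incl ⋙ (linearCoyoneda k C).obj y) a n h

lemma act_indTensorRight (N : RMod k S.Obj) {y y' : Cᵒᵖ} (f : y ⟶ y') (z : S.Obj)
    (n : N.obj.obj (op z)) (h : y.unop ⟶ z.as) :
    act (S.inductionRight N) f (indTensorRight N y z n h) =
      indTensorRight N y' z n (f.unop ≫ h) :=
  tensorMap_pureTensor (𝟙 N.obj) (Functor.whiskerLeft S.incl ((linearCoyoneda k C).map f)) z n h

lemma indRight_linear_ext {N : RMod k S.Obj} {y : Cᵒᵖ} {P : Type u} [AddCommGroup P] [Module k P]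
    {f g : (S.inductionRight N).obj.obj y →ₗ[k] P}
    (h : ∀ z n a, f (indTensorRight N y z n a) = g (indTensorRight N y z n a)) : f = g :=
  tensor_linear_ext (M := S.incl ⋙ (linearCoyoneda k C).obj y) h

/-- The linear map out of a value of an induced right module given by a balanced family. -/
def indLiftRight {N : RMod k S.Obj} {y : Cᵒᵖ} {P : Type u} [AddCommGroup P] [Module k P]
    (B : ∀ z : S.Obj, N.obj.obj (op z) →ₗ[k] (y.unop ⟶ z.as) →ₗ[k] P)
    (hB : ∀ {z w : S.Obj} (a : z ⟶ w) (n : N.obj.obj (op w)) (h : y.unop ⟶ z.as),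
      B z (act N a.op n) h = B w n (h ≫ a.1)) : (S.inductionRight N).obj.obj y →ₗ[k] P :=
  tensorLift (M := S.incl ⋙ (linearCoyoneda k C).obj y) B hB

lemma indLiftRight_indTensorRight {N : RMod k S.Obj} {y : Cᵒᵖ} {P : Type u} [AddCommGroup P]
    [Module k P] (B : ∀ z : S.Obj, N.obj.obj (op z) →ₗ[k] (y.unop ⟶ z.as) →ₗ[k] P)
    (hB : ∀ {z w : S.Obj} (a : z ⟶ w) (n : N.obj.obj (op w)) (h : y.unop ⟶ z.as),
      B z (act N a.op n) h = B w n (h ≫ a.1)) (z : S.Obj) (n : N.obj.obj (op z))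
    (h : y.unop ⟶ z.as) : indLiftRight B hB (indTensorRight N y z n h) = B z n h :=
  tensorLift_pureTensor (M := S.incl ⋙ (linearCoyoneda k C).obj y) B hB z n h

end LinSub

namespace GenReedy

variable (R : GenReedy k C)

/-- The class of a morphism in the right standard module. -/
def stdMkRight (x : C) (y : Cᵒᵖ) : (y.unop ⟶ x) →ₗ[k] (R.stdRight x).obj.obj y :=
  quotMk (R.stdSubRight_comp x) y ∘ₗ (opHom k y.unop x).toLinearMap

lemma stdMkRight_surjective (x : C) (y : Cᵒᵖ) : Function.Surjective (R.stdMkRight x y) := by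
  intro m
  obtain ⟨f, hf⟩ := quotMk_surjective (R.stdSubRight_comp x) y m
  exact ⟨f.unop, hf⟩

lemma stdMkRight_eq_zero {x : C} {y : Cᵒᵖ} {f : y.unop ⟶ x}
    (hf : f ∈ R.ideal (R.deg x) y.unop x) : R.stdMkRight x y f = 0 :=
  (quotMk_eq_zero_iff (R.stdSubRight_comp x)).2 hf

open scoped Classical in
/-- The submodules by which the local right module is defined. -/
abbrev locSubRight (x : C) (y : R.plus.Objᵒᵖ) : Submodule k (op (⟨x⟩ : R.plus.Obj) ⟶ y) :=
  if R.deg y.unop.as < R.deg x then ⊤ else ⊥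

lemma locSubRight_comp (x : C) {y z : R.plus.Objᵒᵖ} (f : op (⟨x⟩ : R.plus.Obj) ⟶ y)
    (g : y ⟶ z) (hf : f ∈ R.locSubRight x y) : f ≫ g ∈ R.locSubRight x z := by
  unfold locSubRight at *
  split_ifs with hz
  · trivial
  · split_ifs at hf with hy
    · have hg : g = 0 := by
        by_contra h
        rcases R.plus_deg g.unop.1 g.unop.2
          (fun h' => h (Quiver.Hom.unop_inj (Subtype.ext h'))) with h' | h'
        · exact hz (h' ▸ hy)
        · exact hz (h'.trans hy)
      rw [hg, comp_zero]
      exact zero_mem _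
    · rw [(Submodule.mem_bot k).1 hf, zero_comp]
      exact zero_mem _

/-- The class of a morphism in the local right module. -/
def locMkRight (x : C) (y : R.plus.Obj) :
    (op (⟨x⟩ : R.plus.Obj) ⟶ op y) →ₗ[k]
      (R.localRight x).obj.obj (op y) :=
  quotMk (R.locSubRight_comp x) (op y)

lemma locMkRight_surjective (x : C) (y : R.plus.Obj) : Function.Surjective (R.locMkRight x y) :=
  quotMk_surjective (R.locSubRight_comp x) (op y)

lemma act_locMkRight {x : C} {y z : R.plus.Obj}
    (f : op (⟨x⟩ : R.plus.Obj) ⟶ op y) (g : op y ⟶ op z) :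
    act (R.localRight x) g (R.locMkRight x y f) = R.locMkRight x z (f ≫ g) := rfl

lemma locMkRight_eq_zero {x : C} {y : R.plus.Obj}
    (f : op (⟨x⟩ : R.plus.Obj) ⟶ op y) (hy : R.deg y.as < R.deg x) :
    R.locMkRight x y f = 0 := by
  refine (quotMk_eq_zero_iff (R.locSubRight_comp x)).2 ?_
  rw [locSubRight, if_pos hy]
  trivial

/-- The relation `1 ⊗ (f ∘ h) = f ⊗ h` for `f` in `C⁺`. It kills the ideal when the source of `f`
has degree below `deg x`, and it shows that the two maps of the isomorphism are inverse to each
other. -/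
lemma indTensorRight_locMkRight (x : C) (y : Cᵒᵖ) {z : R.plus.Obj} (f : z ⟶ ⟨x⟩)
    (h : y.unop ⟶ z.as) :
    LinSub.indTensorRight (R.localRight x) y ⟨x⟩ (R.locMkRight x ⟨x⟩ (𝟙 _)) (h ≫ f.1) =
      LinSub.indTensorRight (R.localRight x) y z (R.locMkRight x z f.op) h := by
  rw [← LinSub.indTensorRight_balanced, act_locMkRight, Category.id_comp]

/-- The linear map from a value of the right standard module to the induced module. -/
def stdToIndRightAt (x : C) (y : Cᵒᵖ) :
    (R.stdRight x).obj.obj y →ₗ[k] (R.plus.inductionRight (R.localRight x)).obj.obj y :=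
  quotLift (R.stdSubRight_comp x) y
    (LinSub.indTensorRight (R.localRight x) y ⟨x⟩ (R.locMkRight x ⟨x⟩ (𝟙 _)) ∘ₗ
      (opHom k y.unop x).symm.toLinearMap) fun f hf => by
    suffices h : R.ideal (R.deg x) y.unop x ≤ LinearMap.ker
      (LinSub.indTensorRight (R.localRight x) y ⟨x⟩ (R.locMkRight x ⟨x⟩ (𝟙 _))) from h hf
    refine Submodule.span_le.2 ?_
    rintro _ ⟨z, g, f, hz, hg, hf, rfl⟩
    rw [SetLike.mem_coe, LinearMap.mem_ker]
    refine (R.indTensorRight_locMkRight x y (z := ⟨z⟩) ⟨f, hf⟩ g).trans ?_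
    rw [R.locMkRight_eq_zero _ hz, map_zero, LinearMap.zero_apply]

lemma stdToIndRightAt_stdMkRight (x : C) (y : Cᵒᵖ) (f : y.unop ⟶ x) :
    R.stdToIndRightAt x y (R.stdMkRight x y f) =
      LinSub.indTensorRight (R.localRight x) y ⟨x⟩ (R.locMkRight x ⟨x⟩ (𝟙 _)) f := rfl

/-- The morphism from the right standard module to the induced module. -/
def stdToIndRight (x : C) : R.stdRight x ⟶ R.plus.inductionRight (R.localRight x) :=
  homOfComps (R.stdToIndRightAt x) fun {y z} f m => by
    obtain ⟨g, rfl⟩ := R.stdMkRight_surjective x y m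
    rw [stdToIndRightAt_stdMkRight, LinSub.act_indTensorRight]
    rfl

/-- The action of a class in the local right module by composition. -/
def locBilinRight (x : C) (y : Cᵒᵖ) (z : R.plus.Obj) :
    (R.localRight x).obj.obj (op z) →ₗ[k] (y.unop ⟶ z.as) →ₗ[k]
      (R.stdRight x).obj.obj y :=
  quotLift (R.locSubRight_comp x) (op z)
    (LinearMap.mk₂ k (fun f h => R.stdMkRight x y (h ≫ f.unop.1))
      (fun f f' h => (congrArg _ (Preadditive.comp_add _ _ _ h f.unop.1 f'.unop.1)).trans
        (map_add _ _ _))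
      (fun r f h => (congrArg _ (Linear.comp_smul _ _ _ h r f.unop.1)).trans (map_smul _ _ _))
      (fun f h h' => (congrArg _ (Preadditive.add_comp _ _ _ h h' f.unop.1)).trans
        (map_add _ _ _))
      (fun r f h => (congrArg _ (Linear.smul_comp _ _ _ r h f.unop.1)).trans (map_smul _ _ _)))
    fun f hf => by
      refine LinearMap.ext fun h => R.stdMkRight_eq_zero ?_
      by_cases hz : R.deg z.as < R.deg x
      · exact R.comp_ideal _ _ _ (Submodule.subset_span
          ⟨z.as, 𝟙 _, f.unop.1, hz, R.minus.id_mem _, f.unop.2, (Category.id_comp _).symm⟩)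
      · rw [locSubRight, if_neg hz] at hf
        rw [(Submodule.mem_bot k).1 hf]
        exact (comp_zero (f := h) (Z := x)).symm ▸ zero_mem (R.ideal (R.deg x) y.unop x)

lemma locBilinRight_locMkRight (x : C) (y : Cᵒᵖ) (z : R.plus.Obj)
    (f : op (⟨x⟩ : R.plus.Obj) ⟶ op z) (h : y.unop ⟶ z.as) :
    R.locBilinRight x y z (R.locMkRight x z f) h = R.stdMkRight x y (h ≫ f.unop.1) := rfl

lemma locBilinRight_balanced (x : C) (y : Cᵒᵖ) {z w : R.plus.Obj} (a : z ⟶ w)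
    (n : (R.localRight x).obj.obj (op w)) (h : y.unop ⟶ z.as) :
    R.locBilinRight x y z (act (R.localRight x) a.op n) h =
      R.locBilinRight x y w n (h ≫ a.1) := by
  obtain ⟨f, rfl⟩ := R.locMkRight_surjective x w n
  rw [act_locMkRight, locBilinRight_locMkRight, locBilinRight_locMkRight, Category.assoc]
  rfl

/-- The inverse sends `f ⊗ h` to the class of `f ∘ h`. -/
lemma stdToIndRightAt_bijective (x : C) (y : Cᵒᵖ) :
    Function.Bijective (R.stdToIndRightAt x y) := by
  refine Function.bijective_iff_has_inverse.2
    ⟨LinSub.indLiftRight (R.locBilinRight x y) (R.locBilinRight_balanced x y), fun m => ?_,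
      fun t => ?_⟩
  · obtain ⟨f, rfl⟩ := R.stdMkRight_surjective x y m
    rw [stdToIndRightAt_stdMkRight, LinSub.indLiftRight_indTensorRight, locBilinRight_locMkRight]
    exact congrArg _ (Category.comp_id f)
  · refine LinearMap.congr_fun (f := R.stdToIndRightAt x y ∘ₗ
      LinSub.indLiftRight (R.locBilinRight x y) (R.locBilinRight_balanced x y))
      (g := LinearMap.id) (LinSub.indRight_linear_ext fun z n h => ?_) t
    obtain ⟨f, rfl⟩ := R.locMkRight_surjective x z n
    rw [LinearMap.comp_apply, LinSub.indLiftRight_indTensorRight, locBilinRight_locMkRight,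
      stdToIndRightAt_stdMkRight]
    exact R.indTensorRight_locMkRight x y f.unop h

/-- The right standard module is induced from the local algebra. -/
lemma isIso_stdToIndRight (x : C) : IsIso (R.stdToIndRight x) := by
  have := mono_of_comps_injective (R.stdToIndRight x)
    fun y => (R.stdToIndRightAt_bijective x y).1
  have := epi_of_comps_surjective (R.stdToIndRight x)
    fun y => (R.stdToIndRightAt_bijective x y).2
  exact isIso_of_mono_of_epi _

end GenReedy

end InductionRight

end LinReedy

theorem theoremA {k : Type u} [CommRing k] {C : Type u} [SmallCategory C] [Preadditive C]
    [Linear k C] (R : LinReedy.GenReedy k C) :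
    (Projective R.plusRight →
      (∀ x : C, Nonempty (R.stdLeft x ≅ R.minus.inductionLeft (R.localLeft x))) ∧
      (∀ x : C, Nonempty (End (R.stdLeft x) ≃ₐ[k] (R.localAlg x)ᵐᵒᵖ)) ∧
      (∀ x y : C, Nontrivial (R.stdLeft x ⟶ R.stdLeft y) → x = y ∨ R.deg y < R.deg x) ∧
      (∀ (x y : C) (n : ℕ), 1 ≤ n →
        Nontrivial (Abelian.Ext (R.stdLeft x) (R.stdLeft y) n) → R.deg y < R.deg x)) ∧
    (Projective R.minusLeft →
      (∀ x : C, Nonempty (R.stdRight x ≅ R.plus.inductionRight (R.localRight x))) ∧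
      (∀ x : C, Nonempty (End (R.stdRight x) ≃ₐ[k] R.localAlg x)) ∧
      (∀ x y : C, Nontrivial (R.stdRight x ⟶ R.stdRight y) → x = y ∨ R.deg y < R.deg x) ∧
      (∀ (x y : C) (n : ℕ), 1 ≤ n →
        Nontrivial (Abelian.Ext (R.stdRight x) (R.stdRight y) n) → R.deg y < R.deg x)) := by
  refine ⟨fun _ => ⟨fun x => ⟨R.stdIsoInd x⟩, fun x => ⟨R.stdEndEquiv x⟩,
    fun x y => R.eq_or_deg_lt_of_nontrivial_hom, fun x y n hn h => ?_⟩,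
    fun _ => ⟨fun x => ?_, fun x => ?_, fun x y h => ?_, fun x y n hn h => ?_⟩⟩
  · have := fun y => (R.plusDualBasis y).projective_restrictedRep
    exact LinReedy.GenReedy.deg_lt_of_nontrivial_ext hn h
  · have := R.isIso_stdToIndRight x
    exact ⟨asIso (R.stdToIndRight x)⟩
  · rw [R.stdRight_eq]
    -- Two reversals cancel: the left-hand result gives the opposite of the local algebra of the
    -- opposite category, which is `A_x⁰` itself.
    exact ⟨(R.opposite.stdEndEquiv (op x)).trans
      (AlgEquiv.ofBijective _ (R.localAlgOp_bijective x))⟩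
  · rw [R.stdRight_eq, R.stdRight_eq] at h
    exact (R.opposite.eq_or_deg_lt_of_nontrivial_hom h).imp op_injective.eq_iff.1 id
  · rw [R.stdRight_eq, R.stdRight_eq] at h
    have := fun y => (R.op_plusDualBasis y).projective_restrictedRep
    exact LinReedy.GenReedy.deg_lt_of_nontrivial_ext (R := R.opposite) hn h
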